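/- Let $F\subseteq K\subseteq L$ be finite fields, $|F|=q$, $|K|=q^a$, $|L|=q^m$, $r=m/a$, let $\sigma(x)=x^q$, let $n\ge 1$ be a multiple of $m$ and $\ell\ge 0$. In the skew polynomial rings $K[X;\sigma]\subseteq L[X;\sigma]$ one has $X\alpha=\sigma(\alpha)X$. Put $P_n=K[X;\sigma]/(X^n-1)$ and $R_n=L[X;\sigma]/(X^n-1)$, and let $\pi:L[X;\sigma]^\ell\to R_n^\ell$ be the projection. Let $\mathcal C\subseteq L^{n\ell}$ be a $K$-linear skew quasi-cyclic code of index $\ell$: a $K$-subspace such that, for a suitable arrangement of the coordinates in an $n\times\ell$ array, $(c_{i,j})\in\mathcal C$ implies $(\sigma(c_{i-1,j}))\in\mathcal C$ (row indices modulo $n$; $\ell$ need not be minimal). The map $(c_{i,j})\mapsto\bigl(\sum_{i=0}^{n-1}c_{i,j}X^i\bigr)_{0\le j<\ell}$ is a bijection $L^{n\ell}\to R_n^\ell$ and identifies $\mathcal C$ with a left $P_n$-submodule of $R_n^\ell$. Let $b_1,\dots,b_r$ be a basis of $L$ over $K$. Then $L[X;\sigma]=\bigoplus_i K[X;\sigma]b_i$,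 which identifies $L[X;\sigma]^\ell$ with $K[X;\sigma]^{r\ell}$ and $\pi^{-1}(\mathcal C)$ with a left $K[X;\sigma]$-submodule of $K[X;\sigma]^{r\ell}$. There are $\dim_K\mathcal C$ vectors in $K[X;\sigma]^{r\ell}$ whose images under $\pi$ generate $\mathcal C$ as a $P_n$-module. Let $g_1,\dots,g_k\in K[X;\sigma]^{r\ell}$ be any finite family whose images generate $\mathcal C$ as a $P_n$-module, and let $M$ be the $(k+r\ell)\times r\ell$ matrix with the rows $g_1,\dots,g_k$ followed by the rows of $(X^n-1)\mathrm{Id}_{r\ell}$. (1) $M$ has a Smith normal form: there are invertible matrices $S,T$ over $K[X;\sigma]$ such that $SMT$ is zero except for the diagonal entries $h_1,\dots,h_{r\ell}$, and each $h_i$ is a total divisor of $h_{i+1}$. (Here $s$ is a total divisor of $t$ if for all $u$ there are $w,w'$ with $ut=sw$ and $tu=w's$.) (2) For every such $S,T,h_1,\dots,h_{r\ell}$, let $\boldsymbol q_i$ be the $i$-th row of $T^{-1}$ and $\boldsymbol c_i=h_i\boldsymbol q_i$. Then $(\boldsymbol q_i)$ is a basis of the left module $K[X;\sigma]^{r\ell}$,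 $(\boldsymbol c_i)$ is a basis of $\pi^{-1}(\mathcal C)$, there are $d_i\in K[X;\sigma]$ with $h_id_i=d_ih_i=X^n-1$, and $(d_i\boldsymbol c_i)$ is a basis of $(X^n-1)K[X;\sigma]^{r\ell}\subseteq\pi^{-1}(\mathcal C)$. Moreover, both as $K[X;\sigma]$-modules and as $P_n$-modules, $$\mathcal C\;\cong\;\pi^{-1}(\mathcal C)\big/(X^n-1)K[X;\sigma]^{r\ell}=\Bigl(\bigoplus_{i=1}^{r\ell}K[X;\sigma]\boldsymbol c_i\Bigr)\Big/\Bigl(\bigoplus_{i=1}^{r\ell}K[X;\sigma]d_i\boldsymbol c_i\Bigr)\;\cong\;\bigoplus_{i=1}^{r\ell}K[X;\sigma]/K[X;\sigma]d_i,$$ where the first isomorphism is induced by $\pi$ and the second maps the class of $\sum_i f_i\boldsymbol c_i$ to $(f_i+K[X;\sigma]d_i)_i$. -/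

import Mathlib

noncomputable section

namespace SkewQC

/-! ### Skew polynomial rings over a finite field, twisted by the `q`-Frobenius -/

/-- The action of `ℕ` on an extension `K` of the finite field `F` with `q` elements in which
`k` acts as the `k`-th power of the Frobenius automorphism `σ x = x ^ q`. -/
@[reducible]
def frobeniusAction (F K : Type*) [Field F] [Fintype F] [Field K] [Algebra F K] :
    MulSemiringAction (Multiplicative ℕ) K where
  smul k x := x ^ (Fintype.card F ^ k.toAdd)
  one_smul x := by
    change x ^ (Fintype.card F ^ 0) = x
    simp
  mul_smul j k x := by
    change x ^ (Fintype.card F ^ (j.toAdd + k.toAdd)) =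
      (x ^ (Fintype.card F ^ k.toAdd)) ^ (Fintype.card F ^ j.toAdd)
    rw [← pow_mul, ← pow_add, add_comm]
  smul_zero k := by
    change (0 : K) ^ (Fintype.card F ^ k.toAdd) = 0
    exact zero_pow (pow_ne_zero _ Fintype.card_ne_zero)
  smul_add k x y := by
    change (x + y) ^ (Fintype.card F ^ k.toAdd) =
      x ^ (Fintype.card F ^ k.toAdd) + y ^ (Fintype.card F ^ k.toAdd)
    have h : ∀ z : K, z ^ (Fintype.card F ^ k.toAdd) =
        (FiniteField.frobeniusAlgHom F K ^ k.toAdd) z := by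
      intro z
      induction k.toAdd with
      | zero => simp
      | succ j ih =>
        rw [pow_succ, pow_mul, ih, pow_succ' (FiniteField.frobeniusAlgHom F K)]
        change _ = FiniteField.frobeniusAlgHom F K ((FiniteField.frobeniusAlgHom F K ^ j) z)
        simp
    simp only [h, map_add]
  smul_one k := by
    change (1 : K) ^ (Fintype.card F ^ k.toAdd) = 1
    simp
  smul_mul k x y := by
    change (x * y) ^ (Fintype.card F ^ k.toAdd) = _
    exact mul_pow _ _ _

/-- The skew polynomial ring `K[X; σ]`, where `σ x = x ^ q` and `q` is the cardinality of `F`: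
its elements are the polynomials `∑ aᵢ Xⁱ` with `aᵢ` in `K`, and `X * a = σ a * X`. -/
def SkewPoly (F K : Type*) [Field F] [Fintype F] [Field K] [Algebra F K] : Type _ :=
  SkewPolynomial K

section Rings

variable (F K L : Type*) [Field F] [Fintype F] [Field K] [Field L]
  [Algebra F K] [Algebra F L] [Algebra K L]

instance : Ring (SkewPoly F K) :=
  letI := frobeniusAction F K
  inferInstanceAs (Ring (SkewPolynomial K))

variable {K} in
/-- The monomial `a Xⁱ` of `K[X; σ]`. -/
def monomial (i : ℕ) (a : K) : SkewPoly F K := SkewPolynomial.monomial i a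

/-- The polynomial `X ^ n - 1` of `K[X; σ]`. -/
def xPowSubOne (n : ℕ) : SkewPoly F K := monomial F 1 (1 : K) ^ n - 1

theorem monomial_add (i : ℕ) (a b : K) :
    monomial F i (a + b) = monomial F i a + monomial F i b :=
  SkewPolynomial.monomial_add i a b

theorem monomial_mul_monomial (i j : ℕ) (a b : K) :
    monomial F i a * monomial F j b =
      monomial F (i + j) (a * b ^ (Fintype.card F ^ i)) := by
  let _ := frobeniusAction F K
  have h := SkewPolynomial.monomial_mul_monomial i j a b
  rw [SkewPolynomial.φ_iterate_apply] at h
  exact h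

theorem monomial_zero_one : monomial F 0 (1 : K) = 1 := rfl

theorem monomial_one_one_pow (i : ℕ) : monomial F 1 (1 : K) ^ i = monomial F i 1 := by
  induction i with
  | zero => rfl
  | succ i ih => rw [pow_succ, ih, monomial_mul_monomial]; simp

theorem skewPoly_induction {P : SkewPoly F K → Prop} (h0 : P 0)
    (hadd : ∀ p p', P p → P p' → P (p + p')) (hm : ∀ i a, P (monomial F i a))
    (p : SkewPoly F K) : P p :=
  SkewPolynomial.induction (motive := P) p h0 fun i a _ _ _ hq => hadd _ _ (hm i a) hq

/-- The inclusion `K[X; σ] → L[X; σ]`, `∑ aᵢ Xⁱ ↦ ∑ aᵢ Xⁱ`, for fields `K ⊆ L`. -/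
def incl : SkewPoly F K →+* SkewPoly F L :=
  letI := frobeniusAction F K
  letI := frobeniusAction F L
  SkewMonoidAlgebra.liftNCRingHom (k := K) (G := Multiplicative ℕ) (R := SkewPolynomial L)
    (SkewMonoidAlgebra.singleOneRingHom.comp (algebraMap K L))
    (SkewMonoidAlgebra.of L (Multiplicative ℕ)) (by
      intro x y
      have h : algebraMap K L (y • x) = y • algebraMap K L x :=
        map_pow (algebraMap K L) x (Fintype.card F ^ y.toAdd)
      change SkewMonoidAlgebra.single 1 (algebraMap K L (y • x)) * SkewMonoidAlgebra.single y 1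
        = SkewMonoidAlgebra.single y 1 * SkewMonoidAlgebra.single 1 (algebraMap K L x)
      rw [SkewMonoidAlgebra.single_mul_single, SkewMonoidAlgebra.single_mul_single, h]
      simp)

theorem incl_monomial (i : ℕ) (a : K) :
    incl F K L (monomial F i a) = monomial F i (algebraMap K L a) := by
  let _ := frobeniusAction F L
  refine (SkewMonoidAlgebra.liftNC_single (R := SkewPolynomial L) _ _ _ _).trans ?_
  change SkewMonoidAlgebra.single 1 (algebraMap K L a) * SkewMonoidAlgebra.single _ 1 =
    SkewMonoidAlgebra.single _ _
  rw [SkewMonoidAlgebra.single_mul_single]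
  simp

theorem incl_xPowSubOne (n : ℕ) : incl F K L (xPowSubOne F K n) = xPowSubOne F L n := by
  simp [xPowSubOne, incl_monomial]

/-- The two-sided ideal `(X ^ n - 1)` of `K[X; σ]`. -/
def xIdeal (n : ℕ) : Ideal (SkewPoly F K) :=
  (TwoSidedIdeal.span {xPowSubOne F K n}).asIdeal

instance (n : ℕ) : (xIdeal F K n).IsTwoSided := by
  unfold xIdeal; infer_instance

theorem xPowSubOne_mem_xIdeal (n : ℕ) : xPowSubOne F K n ∈ xIdeal F K n := by
  rw [xIdeal, TwoSidedIdeal.mem_asIdeal]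
  exact TwoSidedIdeal.subset_span rfl

theorem xIdeal_le (n : ℕ) (I : Ideal (SkewPoly F K)) [I.IsTwoSided]
    (h : xPowSubOne F K n ∈ I) : xIdeal F K n ≤ I := by
  intro p hp
  rw [xIdeal, TwoSidedIdeal.mem_asIdeal] at hp
  have : TwoSidedIdeal.span {xPowSubOne F K n} ≤ I.toTwoSided := by
    rw [TwoSidedIdeal.span_le]
    simpa using h
  simpa using this hp

/-- The ring `Pₙ = K[X; σ] / (X ^ n - 1)`. -/
def PQuot (n : ℕ) : Type _ := SkewPoly F K ⧸ xIdeal F K n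

instance (n : ℕ) : Ring (PQuot F K n) := inferInstanceAs (Ring (SkewPoly F K ⧸ xIdeal F K n))

/-- The projection `K[X; σ] → Pₙ`. -/
def toPQuot (n : ℕ) : SkewPoly F K →+* PQuot F K n := Ideal.Quotient.mk (xIdeal F K n)

theorem toPQuot_surjective (n : ℕ) : Function.Surjective (toPQuot F K n) := Ideal.Quotient.mk_surjective

/-- The ring `Rₙ = L[X; σ] / (X ^ n - 1)`. -/
def RQuot (n : ℕ) : Type _ := SkewPoly F L ⧸ xIdeal F L n

instance (n : ℕ) : Ring (RQuot F L n) := inferInstanceAs (Ring (SkewPoly F L ⧸ xIdeal F L n))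

/-- The projection `L[X; σ] → Rₙ`. -/
def toRQuot (n : ℕ) : SkewPoly F L →+* RQuot F L n := Ideal.Quotient.mk (xIdeal F L n)

theorem toRQuot_xPowSubOne (n : ℕ) : toRQuot F L n (xPowSubOne F L n) = 0 :=
  Ideal.Quotient.eq_zero_iff_mem.2 (xPowSubOne_mem_xIdeal F L n)

/-- The canonical ring homomorphism `Pₙ → Rₙ` induced by `K[X; σ] ⊆ L[X; σ]`. -/
def inclQuot (n : ℕ) : PQuot F K n →+* RQuot F L n :=
  Ideal.quotientMap (I := xIdeal F K n) (xIdeal F L n) (incl F K L) (by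
    apply xIdeal_le
    rw [Ideal.mem_comap, incl_xPowSubOne]
    exact xPowSubOne_mem_xIdeal F L n)

theorem inclQuot_toPQuot (n : ℕ) (p : SkewPoly F K) :
    inclQuot F K L n (toPQuot F K n p) = toRQuot F L n (incl F K L p) := rfl

/-- `Rₙ` as a left module over its subring `Pₙ`. -/
instance (n : ℕ) : Module (PQuot F K n) (RQuot F L n) := Module.compHom _ (inclQuot F K L n)

theorem PQuot_smul_def (n : ℕ) (p : PQuot F K n) (x : RQuot F L n) : p • x = inclQuot F K L n p * x := rfl

/-- Every `Pₙ`-submodule is a left `K[X; σ]`-module through the projection `K[X; σ] → Pₙ`. -/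
instance (n : ℕ) {M : Type*} [AddCommGroup M] [Module (PQuot F K n) M]
    (N : Submodule (PQuot F K n) M) : Module (SkewPoly F K) N :=
  Module.compHom N (toPQuot F K n)

variable {F K} in
/-- A left `K[X; σ]`-module that is annihilated by `X ^ n - 1` is a `Pₙ`-module: the class of `p`
acts as `p`. -/
@[reducible]
def pModule {n : ℕ} {M : Type*} [AddCommGroup M] [Module (SkewPoly F K) M]
    (h : ∀ x : M, xPowSubOne F K n • x = 0) : Module (PQuot F K n) M :=
  have hM : Module.IsTorsionBySet (SkewPoly F K) M (xIdeal F K n) := by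
    intro x p
    have := xIdeal_le F K n (Module.annihilator (SkewPoly F K) M)
      (Module.mem_annihilator.2 h) p.2
    exact Module.mem_annihilator.1 this x
  (hM.module : Module (SkewPoly F K ⧸ xIdeal F K n) M)

theorem pModule_toPQuot_smul {n : ℕ} {M : Type*} [AddCommGroup M] [Module (SkewPoly F K) M]
    (h : ∀ x : M, xPowSubOne F K n • x = 0) (p : SkewPoly F K) (x : M) :
    letI := pModule h
    toPQuot F K n p • x = p • x := rfl

end Rings

/-! ### Skew quasi-cyclic codes -/

section Codes

variable (F : Type*) {K L : Type*} [Field F] [Fintype F] [Field K] [Field L]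
  [Algebra F K] [Algebra F L] [Algebra K L] {n ℓ : ℕ}

/-- The coordinates of a word `c` of length `n * ℓ` are arranged by the bijection `τ` in an array
with `n` rows and `ℓ` columns, `c_{i,j} = c (τ (i, j))`. The skew shift applies `σ x = x ^ q` to
all entries and moves every row of the array cyclically one step down. For the row-by-row
arrangement `τ (i, j) = i * ℓ + j`, this is the cyclic shift by `ℓ` positions followed by `σ`. -/
def skewShift [NeZero n] (τ : Fin n × Fin ℓ ≃ Fin (n * ℓ)) (c : Fin (n * ℓ) → L) : Fin (n * ℓ) → L :=
  fun k => c (τ ((τ.symm k).1 - 1, (τ.symm k).2)) ^ Fintype.card F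

/-- The `K`-subspace `C` of `L ^ (n * ℓ)` is a skew quasi-cyclic code of index `ℓ`, for the
arrangement (that is, up to the reordering) `τ` of the coordinates. -/
def IsSkewQuasiCyclic [NeZero n] (τ : Fin n × Fin ℓ ≃ Fin (n * ℓ))
    (C : Submodule K (Fin (n * ℓ) → L)) : Prop :=
  ∀ c ∈ C, skewShift F τ c ∈ C

/-- The map `φ : L ^ (n * ℓ) → Rₙ ^ ℓ` that sends an array to the vector of the classes of the
polynomials `c_j(X) = ∑ i, c_{i,j} Xⁱ`, one for each column. -/
def phi (τ : Fin n × Fin ℓ ≃ Fin (n * ℓ)) (c : Fin (n * ℓ) → L) : Fin ℓ → RQuot F L n :=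
  fun j => toRQuot F L n (∑ i : Fin n, monomial F i (c (τ (i, j))))


variable (K) in
theorem phi_smul (τ : Fin n × Fin ℓ ≃ Fin (n * ℓ)) (a : K) (c : Fin (n * ℓ) → L) :
    toPQuot F K n (monomial F 0 a) • phi F τ c = phi F τ (a • c) := by
  funext j
  rw [Pi.smul_apply, PQuot_smul_def, inclQuot_toPQuot, phi, phi, ← map_mul, incl_monomial,
    Finset.mul_sum]
  congr 1
  refine Finset.sum_congr rfl fun i _ => ?_
  rw [monomial_mul_monomial]
  simp [Algebra.smul_def]

theorem toRQuot_monomial_length (a : L) :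
    toRQuot F L n (monomial F n a) = toRQuot F L n (monomial F 0 a) := by
  have h : monomial F 0 a * xPowSubOne F L n = monomial F n a - monomial F 0 a := by
    rw [xPowSubOne, mul_sub, monomial_one_one_pow, monomial_mul_monomial]
    simp
  have h' := congrArg (toRQuot F L n) h
  rw [map_mul, toRQuot_xPowSubOne, mul_zero, map_sub] at h'
  exact (sub_eq_zero.1 h'.symm)

theorem fin_val_add_one [NeZero n] (i : Fin n) : ((i + 1 : Fin n) : ℕ) = ((i : ℕ) + 1) % n := by
  rw [Fin.val_add, Fin.val_one', Nat.add_mod_mod]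

variable (K) in
theorem phi_skewShift [NeZero n] (τ : Fin n × Fin ℓ ≃ Fin (n * ℓ)) (c : Fin (n * ℓ) → L) :
    toPQuot F K n (monomial F 1 1) • phi F τ c = phi F τ (skewShift F τ c) := by
  funext j
  rw [Pi.smul_apply, PQuot_smul_def, inclQuot_toPQuot, phi, phi, ← map_mul, incl_monomial,
    Finset.mul_sum, map_sum, map_sum]
  refine Fintype.sum_equiv (Equiv.addRight (1 : Fin n)) _ _ fun i => ?_
  rw [monomial_mul_monomial]
  simp only [skewShift, Equiv.symm_apply_apply, Equiv.coe_addRight, add_sub_cancel_right,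
    map_one, one_mul, pow_one]
  by_cases h : (i : ℕ) + 1 = n
  · rw [fin_val_add_one, h, Nat.mod_self, add_comm 1, h, toRQuot_monomial_length]
  · rw [fin_val_add_one, Nat.mod_eq_of_lt (by omega), add_comm 1]

theorem phi_zero (τ : Fin n × Fin ℓ ≃ Fin (n * ℓ)) : phi F τ (0 : Fin (n * ℓ) → L) = 0 := by
  funext j
  rw [phi, Finset.sum_eq_zero, map_zero, Pi.zero_apply]
  exact fun i _ => SkewPolynomial.monomial_zero_right _

theorem phi_add (τ : Fin n × Fin ℓ ≃ Fin (n * ℓ)) (c d : Fin (n * ℓ) → L) :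
    phi F τ c + phi F τ d = phi F τ (c + d) := by
  funext j
  simp only [Pi.add_apply, phi, ← map_add, ← Finset.sum_add_distrib, monomial_add]

/-- The `Pₙ`-submodule `φ(C)` of `Rₙ ^ ℓ` given by a skew quasi-cyclic code `C`. -/
def codeModule [NeZero n] (τ : Fin n × Fin ℓ ≃ Fin (n * ℓ)) (C : Submodule K (Fin (n * ℓ) → L))
    (hC : IsSkewQuasiCyclic F τ C) : Submodule (PQuot F K n) (Fin ℓ → RQuot F L n) where
  carrier := phi F τ '' C
  zero_mem' := ⟨0, C.zero_mem, phi_zero F τ⟩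
  add_mem' := by
    rintro _ _ ⟨c, hc, rfl⟩ ⟨d, hd, rfl⟩
    exact ⟨c + d, C.add_mem hc hd, (phi_add F τ c d).symm⟩
  smul_mem' := by
    intro p x hx
    obtain ⟨p, rfl⟩ := toPQuot_surjective F K n p
    revert x
    induction p using skewPoly_induction with
    | h0 => exact fun _ => ⟨0, C.zero_mem, by rw [map_zero, zero_smul, phi_zero]⟩
    | hadd p p' hp hp' =>
      intro x hx
      obtain ⟨c, hc, h⟩ := hp hx
      obtain ⟨d, hd, h'⟩ := hp' hx
      exact ⟨c + d, C.add_mem hc hd, by rw [map_add, add_smul, ← h, ← h', phi_add]⟩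
    | hm i a =>
      induction i with
      | zero =>
        rintro _ ⟨c, hc, rfl⟩
        exact ⟨a • c, C.smul_mem a hc, (phi_smul F K τ a c).symm⟩
      | succ i ih =>
        rintro _ ⟨c, hc, rfl⟩
        have h := ih ⟨_, hC c hc, rfl⟩
        rwa [← phi_skewShift F K, ← mul_smul, ← map_mul, monomial_mul_monomial, one_pow,
          mul_one] at h

/-! ### Coordinates over `K[X; σ]`, generator matrices and the Smith normal form -/

/-- The submodule `(X ^ n - 1) K[X; σ] ^ N` of `K[X; σ] ^ N`. -/
def xSubmodule (F K : Type*) [Field F] [Fintype F] [Field K] [Algebra F K] (n N : ℕ) :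
    Submodule (SkewPoly F K) (Fin N → SkewPoly F K) :=
  Submodule.span _ (Set.range fun w : Fin N → SkewPoly F K => fun i => xPowSubOne F K n * w i)

/-- The coordinatewise projection `π : L[X; σ] ^ ℓ → Rₙ ^ ℓ`. -/
def proj (n : ℕ) (v : Fin ℓ → SkewPoly F L) : Fin ℓ → RQuot F L n := fun j => toRQuot F L n (v j)

/-- The identification `K[X; σ] ^ (ℓ * r) → L[X; σ] ^ ℓ` given by a `K`-basis `b` of `L` and the
decomposition `L[X; σ] = ⨁ i, K[X; σ] bᵢ`: the coordinates with the indices `j * r + i`, `i < r`,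
belong to the `j`-th entry. -/
def assemble {r : ℕ} (b : Module.Basis (Fin r) K L) (v : Fin (ℓ * r) → SkewPoly F K) :
    Fin ℓ → SkewPoly F L :=
  fun j => ∑ i : Fin r, incl F K L (v (finProdFinEquiv (j, i))) * monomial F 0 (b i)

theorem proj_assemble_add {r : ℕ} (b : Module.Basis (Fin r) K L)
    (v w : Fin (ℓ * r) → SkewPoly F K) :
    proj F n (assemble F b (v + w)) = proj F n (assemble F b v) + proj F n (assemble F b w) := by
  funext j
  simp only [proj, assemble, Pi.add_apply, map_add, add_mul, Finset.sum_add_distrib]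

theorem proj_assemble_smul {r : ℕ} (b : Module.Basis (Fin r) K L) (p : SkewPoly F K)
    (v : Fin (ℓ * r) → SkewPoly F K) :
    proj F n (assemble F b (p • v)) = toPQuot F K n p • proj F n (assemble F b v) := by
  funext j
  rw [Pi.smul_apply, PQuot_smul_def, inclQuot_toPQuot, proj, proj, ← map_mul, assemble, assemble,
    Finset.mul_sum]
  simp only [Pi.smul_apply, smul_eq_mul, map_mul, mul_assoc]

/-- The preimage `π⁻¹(N)` in `L[X; σ] ^ ℓ` of a `Pₙ`-submodule `N` of `Rₙ ^ ℓ`, written in the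
coordinates of `K[X; σ] ^ (ℓ * r)`. -/
def preimage {r : ℕ} (b : Module.Basis (Fin r) K L)
    (N : Submodule (PQuot F K n) (Fin ℓ → RQuot F L n)) :
    Submodule (SkewPoly F K) (Fin (ℓ * r) → SkewPoly F K) where
  carrier := {v | proj F n (assemble F b v) ∈ N}
  zero_mem' := by
    have h := proj_assemble_smul F (n := n) b 0 (0 : Fin (ℓ * r) → SkewPoly F K)
    rw [map_zero, zero_smul, zero_smul] at h
    change proj F n (assemble F b 0) ∈ N
    rw [h]
    exact N.zero_mem
  add_mem' {v w} hv hw := by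
    change proj F n (assemble F b (v + w)) ∈ N
    rw [proj_assemble_add]
    exact N.add_mem hv hw
  smul_mem' p v hv := by
    change proj F n (assemble F b (p • v)) ∈ N
    rw [proj_assemble_smul]
    exact N.smul_mem _ hv

/-- The quotient module `π⁻¹(N) / (X ^ n - 1) K[X; σ] ^ (ℓ * r)`,
for a `Pₙ`-submodule `N` of `Rₙ ^ ℓ`. -/
abbrev CodeQuotient {r : ℕ} (b : Module.Basis (Fin r) K L)
    (N : Submodule (PQuot F K n) (Fin ℓ → RQuot F L n)) : Type _ :=
  preimage F b N ⧸ (xSubmodule F K n (ℓ * r)).submoduleOf (preimage F b N)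

end Codes

section Matrices

variable {F K : Type*} [Field F] [Fintype F] [Field K] [Algebra F K]

/-- The matrix with the rows `g 0, …, g (k - 1)` on top of `(X ^ n - 1) • 1`. -/
def stackedMatrix (n : ℕ) {k N : ℕ} (g : Fin k → Fin N → SkewPoly F K) :
    Matrix (Fin (k + N)) (Fin N) (SkewPoly F K) :=
  Matrix.of (Fin.append g fun i => Pi.single i (xPowSubOne F K n))

/-- `s` is a total divisor of `t`: for all `u`, `s` is a left divisor of `u * t` and a right
divisor of `t * u`. -/
def IsTotalDivisor {A : Type*} [Ring A] (s t : A) : Prop :=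
  ∀ u : A, (∃ w, u * t = s * w) ∧ (∃ w, t * u = w * s)

/-- `S * M * T = J` is a Smith normal form of the matrix `M`, which has at least as many rows as
columns: `S` and `T` are invertible, and `J` is zero except for the diagonal entries `h i`, each of
which is a total divisor of the next. (So the zero entries on the diagonal, if any, come last.) -/
def IsSmithNormalForm {A : Type*} [Ring A] {k N : ℕ} (M : Matrix (Fin (k + N)) (Fin N) A)
    (S : (Matrix (Fin (k + N)) (Fin (k + N)) A)ˣ) (T : (Matrix (Fin N) (Fin N) A)ˣ)
    (h : Fin N → A) : Prop :=
  S.val * M * T.val = Matrix.of (fun (i : Fin (k + N)) (j : Fin N) => if (i : ℕ) = (j : ℕ) then h j else 0) ∧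
    ∀ i j : Fin N, (i : ℕ) + 1 = j → IsTotalDivisor (h i) (h j)

/-- The rows `qᵢ` of `T⁻¹`. -/
def stackedBasis {A : Type*} [Ring A] {N : ℕ} (T : (Matrix (Fin N) (Fin N) A)ˣ) :
    Fin N → Fin N → A :=
  fun i j => T⁻¹.val i j

/-- The vectors `cᵢ = hᵢ qᵢ`, where the `qᵢ` are the rows of `T⁻¹`. -/
def codeBasis {A : Type*} [Ring A] {N : ℕ} (T : (Matrix (Fin N) (Fin N) A)ˣ) (h : Fin N → A) :
    Fin N → Fin N → A :=
  fun i => h i • stackedBasis T i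

end Matrices

end SkewQC

end

/-! Degrees add under multiplication because K is a field, so K[X;σ] is a domain. A leading term can
be cancelled by a left multiple of a nonzero s and, since σ is bijective on the finite field K, also
by a right multiple. Hence both divisions with remainder exist (`exists_eq_mul_add`,
`exists_eq_mul_add_left`), and the classical pivot argument (`exists_matrixEquivalent_consBlock`,
`exists_isSmithNormalForm`) yields SMT = J.

Write z = X^n - 1 and N = rℓ. Since [K:F] divides n, z is central. The kernel of π in the
coordinates over K[X;σ] is zK[X;σ]^N (`proj_assemble_eq_zero_iff`), so π⁻¹(C), generated by lifts of
generators together with this kernel, is the row space of M (`span_stackedMatrix`). As SM = JT⁻¹,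
this row space is spanned by the c_i = h_i q_i (`IsSmithNormalForm.span_codeBasis`). It contains
each z q_i; comparing coordinates in the basis (q_i) gives d_i h_i = z, and centrality with
cancellation gives h_i d_i = z (`exists_complementary_divisors`). So no h_i or d_i vanishes, the c_i
are independent, and the vectors d_i c_i = z q_i form a basis of zK[X;σ]^N.

A free module modulo multiples d_i c_i of its basis vectors splits into cyclic modules
(`exists_quotientEquiv_directSum`), and the first isomorphism theorem for π identifies the quotient
with C (`exists_codeQuotientEquiv`). -/

noncomputable section

namespace SkewQC

/-! ### Coefficients and size of skew polynomials -/

section Coefficients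

variable {F K : Type*} [Field F] [Fintype F] [Field K] [Algebra F K]

/-- The coefficient of `X ^ i` of a skew polynomial, as an additive map. -/
def coeffHom (i : ℕ) : SkewPoly F K →+ K where
  toFun p := SkewPolynomial.coeff p i
  map_zero' := rfl
  map_add' p p' := by
    change SkewMonoidAlgebra.coeff (_ + _) _ = _
    exact congrFun (congrArg DFunLike.coe (SkewMonoidAlgebra.coeff_add p p')) _

theorem coeffHom_monomial (i j : ℕ) (a : K) :
    coeffHom i (monomial F j a) = if j = i then a else 0 :=
  SkewPolynomial.coeff_monomial

theorem exists_coeffHom_eq_zero (p : SkewPoly F K) : ∃ d, ∀ i, d ≤ i → coeffHom i p = 0 := by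
  induction p using skewPoly_induction with
  | h0 => exact ⟨0, fun i _ => map_zero _⟩
  | hadd p p' hp hp' =>
    obtain ⟨d, hd⟩ := hp
    obtain ⟨e, he⟩ := hp'
    exact ⟨max d e, fun i hi => by
      rw [map_add, hd i (le_of_max_le_left hi), he i (le_of_max_le_right hi), add_zero]⟩
  | hm j a =>
    exact ⟨j + 1, fun i hi => by rw [coeffHom_monomial, if_neg (by omega)]⟩

theorem coeffHom_sum_monomial (d : ℕ) (a : ℕ → K) (j : ℕ) :
    coeffHom j (∑ i ∈ Finset.range d, monomial F i (a i)) = if j < d then a j else 0 := by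
  simp [map_sum, coeffHom_monomial]

theorem coeffHom_ext {p p' : SkewPoly F K} (h : ∀ i, coeffHom i p = coeffHom i p') : p = p' := by
  refine SkewMonoidAlgebra.coeff_injective (Finsupp.ext fun i => ?_)
  exact h i.toAdd

open Classical in
/-- The degree of a skew polynomial plus one, and `0` for the zero polynomial. -/
def size (p : SkewPoly F K) : ℕ := Nat.find (exists_coeffHom_eq_zero p)

theorem size_le_iff {p : SkewPoly F K} {d : ℕ} :
    size p ≤ d ↔ ∀ i, d ≤ i → coeffHom i p = 0 := by
  classical
  refine ⟨fun h i hi => Nat.find_spec (exists_coeffHom_eq_zero p) i (le_trans ?_ hi),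
    fun h => Nat.find_min' _ h⟩
  exact le_trans (le_of_eq (by unfold size; congr)) h

theorem coeffHom_eq_zero_of_size_le {p : SkewPoly F K} {i : ℕ} (h : size p ≤ i) :
    coeffHom i p = 0 :=
  size_le_iff.1 h i le_rfl

theorem coeffHom_ne_zero_of_size_eq {p : SkewPoly F K} {d : ℕ} (h : size p = d + 1) :
    coeffHom d p ≠ 0 := by
  intro h0
  have : size p ≤ d := size_le_iff.2 fun i hi => by
    rcases hi.eq_or_lt with rfl | hi
    · exact h0
    · exact coeffHom_eq_zero_of_size_le (by omega)
  omega

theorem size_eq_zero_iff {p : SkewPoly F K} : size p = 0 ↔ p = 0 := by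
  rw [← Nat.le_zero, size_le_iff]
  refine ⟨fun h => coeffHom_ext fun i => by rw [h i (Nat.zero_le i), map_zero], ?_⟩
  rintro rfl i _
  exact map_zero _

theorem sum_monomial_coeffHom {p : SkewPoly F K} {d : ℕ} (h : size p ≤ d) :
    ∑ i ∈ Finset.range d, monomial F i (coeffHom i p) = p := by
  refine coeffHom_ext fun j => ?_
  rw [coeffHom_sum_monomial]
  split_ifs with hj
  · rfl
  · exact (coeffHom_eq_zero_of_size_le (by omega)).symm

theorem coeffHom_mul_of_size_le {p s : SkewPoly F K} {d e : ℕ} (hp : size p ≤ d) (hs : size s ≤ e)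
    (k : ℕ) : coeffHom k (p * s) =
      ∑ i ∈ Finset.range d, ∑ j ∈ Finset.range e,
        if i + j = k then coeffHom i p * coeffHom j s ^ (Fintype.card F ^ i) else 0 := by
  conv_lhs => rw [← sum_monomial_coeffHom hp, ← sum_monomial_coeffHom hs]
  simp only [Finset.sum_mul_sum, map_sum, monomial_mul_monomial, coeffHom_monomial]

theorem size_mul_le {p s : SkewPoly F K} {d e : ℕ} (hp : size p ≤ d + 1) (hs : size s ≤ e + 1) :
    size (p * s) ≤ d + e + 1 := by
  refine size_le_iff.2 fun k hk => ?_
  rw [coeffHom_mul_of_size_le hp hs]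
  refine Finset.sum_eq_zero fun i hi => Finset.sum_eq_zero fun j hj => if_neg ?_
  rw [Finset.mem_range] at hi hj
  omega

/-- Only the pair (d, e) reaches total degree d + e. The twist falls on the right factor, which is
what separates the two division algorithms below. -/
theorem coeffHom_mul_top {p s : SkewPoly F K} {d e : ℕ} (hp : size p ≤ d + 1)
    (hs : size s ≤ e + 1) :
    coeffHom (d + e) (p * s) = coeffHom d p * coeffHom e s ^ (Fintype.card F ^ d) := by
  rw [coeffHom_mul_of_size_le hp hs, Finset.sum_eq_single_of_mem d (by simp),
    Finset.sum_eq_single_of_mem e (by simp), if_pos rfl]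
  · intro j _ hj
    exact if_neg (by omega)
  · intro i hi hid
    refine Finset.sum_eq_zero fun j hj => if_neg ?_
    rw [Finset.mem_range] at hi hj
    omega

theorem exists_size_eq_add_one {p : SkewPoly F K} (hp : p ≠ 0) : ∃ d, size p = d + 1 :=
  Nat.exists_eq_succ_of_ne_zero (size_eq_zero_iff.not.2 hp)

theorem size_mul {p s : SkewPoly F K} {d e : ℕ} (hp : size p = d + 1) (hs : size s = e + 1) :
    size (p * s) = d + e + 1 := by
  refine le_antisymm (size_mul_le hp.le hs.le) (not_lt.1 fun h => ?_)
  have h0 := coeffHom_eq_zero_of_size_le (Nat.lt_succ_iff.1 h)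
  rw [coeffHom_mul_top hp.le hs.le] at h0
  exact mul_ne_zero (coeffHom_ne_zero_of_size_eq hp)
    (pow_ne_zero _ (coeffHom_ne_zero_of_size_eq hs)) h0

instance : NoZeroDivisors (SkewPoly F K) where
  eq_zero_or_eq_zero_of_mul_eq_zero {p s} h := by
    by_contra! hps
    obtain ⟨d, hd⟩ := exists_size_eq_add_one hps.1
    obtain ⟨e, he⟩ := exists_size_eq_add_one hps.2
    have := size_mul hd he
    rw [h, size_eq_zero_iff.2 rfl] at this
    omega

instance : Nontrivial (SkewPoly F K) :=
  ⟨0, 1, fun h => by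
    have := congrArg (coeffHom 0) h
    rw [← monomial_zero_one, coeffHom_monomial, map_zero, if_pos rfl] at this
    exact zero_ne_one this⟩

instance : IsDomain (SkewPoly F K) := NoZeroDivisors.to_isDomain _

theorem size_monomial_le (i : ℕ) (a : K) : size (monomial F i a) ≤ i + 1 :=
  size_le_iff.2 fun j hj => by rw [coeffHom_monomial, if_neg (by omega)]

/-- Cancellation of leading terms. -/
theorem size_sub_le {p t : SkewPoly F K} {d : ℕ} (hp : size p ≤ d + 1) (ht : size t ≤ d + 1)
    (h : coeffHom d p = coeffHom d t) : size (p - t) ≤ d := by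
  refine size_le_iff.2 fun i hi => ?_
  rw [map_sub]
  rcases hi.eq_or_lt with rfl | hi
  · rw [h, sub_self]
  · rw [coeffHom_eq_zero_of_size_le (hp.trans hi), coeffHom_eq_zero_of_size_le (ht.trans hi),
      sub_zero]

/-- Right division with remainder. -/
theorem exists_eq_mul_add (p : SkewPoly F K) {s : SkewPoly F K} (hs : s ≠ 0) :
    ∃ w t, p = w * s + t ∧ size t < size s := by
  obtain ⟨e, he⟩ := exists_size_eq_add_one hs
  induction hN : size p using Nat.strong_induction_on generalizing p with
  | _ N ih =>
    rcases lt_or_ge N (size s) with hlt | hge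
    · exact ⟨0, p, by rw [zero_mul, zero_add], hN ▸ hlt⟩
    · obtain ⟨k, rfl⟩ : ∃ k, N = k + e + 1 := ⟨N - e - 1, by omega⟩
      -- Multiplying by X^k on the left twists the leading coefficient of s by σ^k, so the quotient
      -- is taken by the twisted coefficient.
      set m := monomial F k (coeffHom (k + e) p / coeffHom e s ^ (Fintype.card F ^ k)) with hm
      have hc : coeffHom (k + e) p = coeffHom (k + e) (m * s) := by
        rw [coeffHom_mul_top (size_monomial_le _ _) he.le, coeffHom_monomial, if_pos rfl,
          div_mul_cancel₀ _ (pow_ne_zero _ (coeffHom_ne_zero_of_size_eq he))]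
      have hle := size_sub_le hN.le (size_mul_le (size_monomial_le _ _) he.le) hc
      obtain ⟨w, t, hwt, ht⟩ := ih _ (Nat.lt_succ_of_le hle) (p - m * s) rfl
      exact ⟨m + w, t, by rw [add_mul, add_assoc, ← hwt, add_sub_cancel], ht⟩

-- σ is injective, hence bijective on a finite field. This is what makes left division possible.
variable (F) in
theorem frobenius_pow_surjective [Finite K] (i : ℕ) :
    Function.Surjective fun x : K => x ^ (Fintype.card F ^ i) := by
  refine Finite.surjective_of_injective ?_
  induction i with
  | zero => intro x y h; simpa using h
  | succ i ih =>
    intro x y h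
    simp only [pow_succ, pow_mul] at h
    exact ih ((FiniteField.frobeniusAlgHom F K).injective h)

/-- Left division with remainder. -/
theorem exists_eq_mul_add_left [Finite K] (p : SkewPoly F K) {s : SkewPoly F K} (hs : s ≠ 0) :
    ∃ w t, p = s * w + t ∧ size t < size s := by
  obtain ⟨e, he⟩ := exists_size_eq_add_one hs
  induction hN : size p using Nat.strong_induction_on generalizing p with
  | _ N ih =>
    rcases lt_or_ge N (size s) with hlt | hge
    · exact ⟨0, p, by rw [mul_zero, zero_add], hN ▸ hlt⟩
    · obtain ⟨k, rfl⟩ : ∃ k, N = e + k + 1 := ⟨N - e - 1, by omega⟩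
      -- Here the unknown coefficient x of the quotient is itself twisted by σ^e, so x is a preimage
      -- under σ^e.
      obtain ⟨x, hx⟩ := frobenius_pow_surjective F e (coeffHom (e + k) p / coeffHom e s)
      simp only at hx
      have hc : coeffHom (e + k) p = coeffHom (e + k) (s * monomial F k x) := by
        rw [coeffHom_mul_top he.le (size_monomial_le _ _), coeffHom_monomial, if_pos rfl, hx,
          mul_div_cancel₀ _ (coeffHom_ne_zero_of_size_eq he)]
      have hle := size_sub_le hN.le (size_mul_le he.le (size_monomial_le _ _)) hc
      obtain ⟨w, t, hwt, ht⟩ := ih _ (Nat.lt_succ_of_le hle) (p - s * monomial F k x) rfl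
      exact ⟨monomial F k x + w, t, by rw [mul_add, add_assoc, ← hwt, add_sub_cancel], ht⟩

/-! ### The central element `X ^ n - 1` -/

theorem xPowSubOne_eq (n : ℕ) : xPowSubOne F K n = monomial F n 1 - monomial F 0 1 := by
  rw [xPowSubOne, monomial_one_one_pow, monomial_zero_one]

/-- |K| = q^[K:F], so q^n is a power of |K|. -/
theorem pow_card_pow_eq_self [Finite K] {n : ℕ} (hn : Module.finrank F K ∣ n) (a : K) :
    a ^ (Fintype.card F ^ n) = a := by
  obtain ⟨k, rfl⟩ := hn
  have := Fintype.ofFinite K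
  rw [pow_mul, ← Nat.card_eq_fintype_card, ← Module.natCard_eq_pow_finrank,
    Nat.card_eq_fintype_card]
  exact FiniteField.pow_card_pow k a

/-- X^n a = σ^n(a) X^n, and σ^n is the identity on K. -/
theorem xPowSubOne_commute [Finite K] {n : ℕ} (hn : Module.finrank F K ∣ n) (p : SkewPoly F K) :
    Commute (xPowSubOne F K n) p := by
  induction p using skewPoly_induction with
  | h0 => exact Commute.zero_right _
  | hadd p p' hp hp' => exact hp.add_right hp'
  | hm i a =>
    rw [Commute, SemiconjBy, xPowSubOne_eq, sub_mul, mul_sub]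
    simp only [monomial_mul_monomial, pow_card_pow_eq_self hn, one_pow, mul_one, one_mul, pow_zero,
      pow_one, zero_add, add_zero, add_comm n i]

theorem size_xPowSubOne {n : ℕ} (hn : n ≠ 0) : size (xPowSubOne F K n) = n + 1 := by
  refine le_antisymm (size_le_iff.2 fun i hi => ?_) (not_lt.1 fun h => ?_)
  · rw [xPowSubOne_eq, map_sub, coeffHom_monomial, coeffHom_monomial, if_neg (by omega),
      if_neg (by omega), sub_zero]
  · have := coeffHom_eq_zero_of_size_le (Nat.lt_succ_iff.1 h)
    rw [xPowSubOne_eq, map_sub, coeffHom_monomial, coeffHom_monomial, if_pos rfl,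
      if_neg (by omega), sub_zero] at this
    exact one_ne_zero this

theorem xPowSubOne_ne_zero {n : ℕ} (hn : n ≠ 0) : xPowSubOne F K n ≠ 0 := fun h => by
  have := size_xPowSubOne (F := F) (K := K) hn
  rw [h, size_eq_zero_iff.2 rfl] at this
  omega

/-- By centrality, the left ideal generated by X^n - 1 is already two-sided. -/
theorem mem_xIdeal_iff [Finite K] {n : ℕ} (hn : Module.finrank F K ∣ n) {p : SkewPoly F K} :
    p ∈ xIdeal F K n ↔ ∃ w, p = w * xPowSubOne F K n := by
  refine ⟨fun h => ?_, ?_⟩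
  · have : (Ideal.span {xPowSubOne F K n}).IsTwoSided := ⟨fun {a} s ha => by
      rw [Ideal.mem_span_singleton'] at ha ⊢
      obtain ⟨w, rfl⟩ := ha
      exact ⟨w * s, by rw [mul_assoc, mul_assoc, (xPowSubOne_commute hn s).eq]⟩⟩
    have := xIdeal_le F K n (Ideal.span {xPowSubOne F K n}) (Ideal.mem_span_singleton_self _) h
    obtain ⟨w, hw⟩ := Ideal.mem_span_singleton'.1 this
    exact ⟨w, hw.symm⟩
  · rintro ⟨w, rfl⟩
    exact Ideal.mul_mem_left _ _ (xPowSubOne_mem_xIdeal F K n)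

end Coefficients

/-! ### Smith normal form over noncommutative Euclidean rings -/

section Smith

variable {A : Type*} [Ring A]

theorem IsTotalDivisor.zero (s : A) : IsTotalDivisor s 0 :=
  fun u => ⟨⟨0, by simp⟩, ⟨0, by simp⟩⟩

theorem IsTotalDivisor.add {s t t' : A} (h : IsTotalDivisor s t) (h' : IsTotalDivisor s t') :
    IsTotalDivisor s (t + t') := fun u => by
  obtain ⟨⟨w, hw⟩, x, hx⟩ := h u
  obtain ⟨⟨w', hw'⟩, x', hx'⟩ := h' u
  exact ⟨⟨w + w', by rw [mul_add, mul_add, hw, hw']⟩, ⟨x + x', by rw [add_mul, add_mul, hx, hx']⟩⟩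

theorem IsTotalDivisor.sum {ι : Type*} {s : A} {t : ι → A} (f : Finset ι)
    (h : ∀ i, IsTotalDivisor s (t i)) : IsTotalDivisor s (∑ i ∈ f, t i) := by
  classical
  induction f using Finset.induction_on with
  | empty => exact IsTotalDivisor.zero s
  | insert i f hi ih => rw [Finset.sum_insert hi]; exact (h i).add ih

/-- The new factor is absorbed into the universally quantified u. With sums, this makes the elements
totally divided by s a two-sided ideal. -/
theorem IsTotalDivisor.mul_left {s t : A} (h : IsTotalDivisor s t) (a : A) :
    IsTotalDivisor s (a * t) := fun u => by
  obtain ⟨w, hw⟩ := (h (u * a)).1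
  obtain ⟨x, hx⟩ := (h u).2
  exact ⟨⟨w, by rw [← mul_assoc, hw]⟩, ⟨a * x, by rw [mul_assoc, hx, mul_assoc]⟩⟩

theorem IsTotalDivisor.mul_right {s t : A} (h : IsTotalDivisor s t) (a : A) :
    IsTotalDivisor s (t * a) := fun u => by
  obtain ⟨w, hw⟩ := (h u).1
  obtain ⟨x, hx⟩ := (h (a * u)).2
  exact ⟨⟨w * a, by rw [← mul_assoc, hw, mul_assoc]⟩, ⟨x, by rw [mul_assoc, hx]⟩⟩

/-- Two rectangular matrices are equivalent if they differ by invertible matrices on both sides. -/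
def MatrixEquivalent {m n : Type*} [Fintype m] [Fintype n] [DecidableEq m] [DecidableEq n]
    (M B : Matrix m n A) : Prop :=
  ∃ (S : (Matrix m m A)ˣ) (T : (Matrix n n A)ˣ), S.val * M * T.val = B

/-! ### Elementary row and column operations -/

section Equivalence

variable {m n : Type*} [Fintype m] [Fintype n] [DecidableEq m] [DecidableEq n]

theorem MatrixEquivalent.refl (M : Matrix m n A) : MatrixEquivalent M M :=
  ⟨1, 1, by simp⟩

theorem MatrixEquivalent.mul {M B : Matrix m n A} (h : MatrixEquivalent M B)
    (S : (Matrix m m A)ˣ) (T : (Matrix n n A)ˣ) : MatrixEquivalent M (S.val * B * T.val) := by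
  obtain ⟨S', T', rfl⟩ := h
  exact ⟨S * S', T' * T, by simp only [Units.val_mul, Matrix.mul_assoc]⟩

theorem MatrixEquivalent.mul_left {M B : Matrix m n A} (h : MatrixEquivalent M B)
    (S : (Matrix m m A)ˣ) : MatrixEquivalent M (S.val * B) := by
  simpa using h.mul S 1

theorem MatrixEquivalent.mul_right {M B : Matrix m n A} (h : MatrixEquivalent M B)
    (T : (Matrix n n A)ˣ) : MatrixEquivalent M (B * T.val) := by
  simpa using h.mul 1 T

/-- The invertible matrix `1 + E`, for a matrix `E` of square zero. -/
def oneAddUnit (E : Matrix m m A) (hE : E * E = 0) : (Matrix m m A)ˣ where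
  val := 1 + E
  inv := 1 - E
  val_inv := by rw [add_mul, mul_sub, mul_sub, hE]; simp
  inv_val := by rw [sub_mul, mul_add, mul_add, hE]; simp

/-- The permutation matrix of `e`, as an invertible matrix. -/
def permUnit (e : Equiv.Perm m) : (Matrix m m A)ˣ where
  val := (1 : Matrix m m A).submatrix e id
  inv := (1 : Matrix m m A).submatrix e.symm id
  val_inv := by
    rw [show (1 : Matrix m m A).submatrix e id = (1 : Matrix m m A).submatrix e (Equiv.refl m)
      from rfl, Matrix.one_submatrix_mul]
    simp
  inv_val := by
    rw [show (1 : Matrix m m A).submatrix e.symm id =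
      (1 : Matrix m m A).submatrix e.symm (Equiv.refl m) from rfl, Matrix.one_submatrix_mul]
    simp

theorem MatrixEquivalent.exists_entry_eq {M B : Matrix m n A} (h : MatrixEquivalent M B)
    (i i' : m) (j j' : n) : ∃ B', MatrixEquivalent M B' ∧ B' i' j' = B i j := by
  have h' := h.mul (permUnit (Equiv.swap i i')) (permUnit (Equiv.swap j j'))
  have hS := Matrix.one_submatrix_mul (Equiv.swap i i') (Equiv.refl m) B
  have hT := Matrix.mul_submatrix_one (Equiv.swap j j') id (B.submatrix (Equiv.swap i i') id)
  refine ⟨B.submatrix (Equiv.swap i i') (Equiv.swap j j'), ?_, by simp⟩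
  convert h' using 1
  exact hT.symm.trans (congrArg (· * _) hS.symm)

/-- Add left multiples of the row `i₀` to the other rows. -/
theorem MatrixEquivalent.add_row {M B : Matrix m n A} (h : MatrixEquivalent M B) (i₀ : m)
    (w : m → A) (hw : w i₀ = 0) :
    MatrixEquivalent M (Matrix.of fun i j => B i j + w i * B i₀ j) := by
  let E : Matrix m m A := Matrix.of fun i i' => if i' = i₀ then w i else 0
  have hE : E * E = 0 := by
    ext i j
    simp [E, Matrix.mul_apply, hw]
  convert h.mul_left (oneAddUnit E hE) using 1
  rw [oneAddUnit, Matrix.add_mul, Matrix.one_mul]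
  ext i j
  simp [E, Matrix.mul_apply]

/-- Add right multiples of the column `j₀` to the other columns. -/
theorem MatrixEquivalent.add_col {M B : Matrix m n A} (h : MatrixEquivalent M B) (j₀ : n)
    (w : n → A) (hw : w j₀ = 0) :
    MatrixEquivalent M (Matrix.of fun i j => B i j + B i j₀ * w j) := by
  let E : Matrix n n A := Matrix.of fun j' j => if j' = j₀ then w j else 0
  have hE : E * E = 0 := by
    ext i j
    simp [E, Matrix.mul_apply, hw]
  convert h.mul_right (oneAddUnit E hE) using 1
  rw [oneAddUnit, Matrix.mul_add, Matrix.mul_one]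
  ext i j
  simp [E, Matrix.mul_apply]

end Equivalence

/-- The block diagonal matrix with the blocks `s` and `M`. -/
def consBlock {m n : ℕ} (s : A) (M : Matrix (Fin m) (Fin n) A) :
    Matrix (Fin (m + 1)) (Fin (n + 1)) A :=
  Matrix.of (Fin.cons (Fin.cons s 0) fun i => Fin.cons 0 (M i))

/-! ### Block diagonal matrices with a 1 × 1 corner -/

section Blocks

variable {l m n : ℕ} (s t : A) (M : Matrix (Fin l) (Fin m) A)

@[simp] theorem consBlock_zero_zero : consBlock s M 0 0 = s := rfl

@[simp] theorem consBlock_zero_succ (j : Fin m) : consBlock s M 0 j.succ = 0 := rfl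

@[simp] theorem consBlock_succ_zero (i : Fin l) : consBlock s M i.succ 0 = 0 := rfl

@[simp] theorem consBlock_succ_succ (i : Fin l) (j : Fin m) :
    consBlock s M i.succ j.succ = M i j := rfl

theorem consBlock_mul (B : Matrix (Fin m) (Fin n) A) :
    consBlock s M * consBlock t B = consBlock (s * t) (M * B) := by
  ext i j
  rw [Matrix.mul_apply, Fin.sum_univ_succ]
  cases i using Fin.cases <;> cases j using Fin.cases <;> simp [Matrix.mul_apply]

theorem consBlock_one : consBlock (1 : A) (1 : Matrix (Fin m) (Fin m) A) = 1 := by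
  ext i j
  cases i using Fin.cases <;> cases j using Fin.cases <;>
    simp [Matrix.one_apply, Fin.succ_ne_zero, (Fin.succ_ne_zero _).symm]

/-- The block diagonal matrix with the blocks `1` and `S`, for an invertible matrix `S`. -/
def consBlockUnit (S : (Matrix (Fin m) (Fin m) A)ˣ) :
    (Matrix (Fin (m + 1)) (Fin (m + 1)) A)ˣ where
  val := consBlock 1 S.val
  inv := consBlock 1 S⁻¹.val
  val_inv := by
    rw [consBlock_mul, one_mul, ← Units.val_mul, mul_inv_cancel, Units.val_one, consBlock_one]
  inv_val := by
    rw [consBlock_mul, one_mul, ← Units.val_mul, inv_mul_cancel, Units.val_one, consBlock_one]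

end Blocks

/-- Over a Euclidean ring, every nonzero matrix is equivalent to a block diagonal one whose
`1 × 1` block is a total divisor of all entries of the other block. -/
theorem exists_matrixEquivalent_consBlock (μ : A → ℕ)
    (hr : ∀ p s : A, s ≠ 0 → ∃ w t, p = w * s + t ∧ μ t < μ s)
    (hl : ∀ p s : A, s ≠ 0 → ∃ w t, p = s * w + t ∧ μ t < μ s)
    {m n : ℕ} {M : Matrix (Fin (m + 1)) (Fin (n + 1)) A} (hM : M ≠ 0) :
    ∃ (s : A) (B : Matrix (Fin m) (Fin n) A), MatrixEquivalent M (consBlock s B) ∧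
      ∀ i j, IsTotalDivisor s (B i j) := by
  classical
  -- The pivot s has the least μ among all nonzero entries of all matrices equivalent to M, so no
  -- iteration of the division algorithm is needed.
  have hex : ∃ d, ∃ B, MatrixEquivalent M B ∧ ∃ i j, B i j ≠ 0 ∧ μ (B i j) = d := by
    by_contra! h
    exact hM (by
      ext i j
      by_contra h0
      exact h _ M (.refl M) i j h0 rfl)
  obtain ⟨B, hB, i, j, h0, hd⟩ := Nat.find_spec hex
  obtain ⟨B, hB, hs⟩ := hB.exists_entry_eq i 0 j 0
  rw [← hs] at h0 hd
  have hmin : ∀ B', MatrixEquivalent M B' → ∀ i j, μ (B' i j) < μ (B 0 0) → B' i j = 0 := by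
    intro B' hB' i j hlt
    by_contra hne
    exact Nat.find_min hex (hd ▸ hlt) ⟨B', hB', i, j, hne, rfl⟩
  clear hs
  generalize hs : B 0 0 = s at *
  -- Subtracting w times row 0 leaves the remainder as an entry of an equivalent matrix, so by
  -- minimality it is zero. Quantifying over all B' with corner s lets the claim be reused after
  -- further operations.
  have hcol : ∀ B', MatrixEquivalent M B' → B' 0 0 = s → ∀ i, ∃ w, B' i 0 = w * s := by
    intro B' hB' h00 i
    rcases eq_or_ne i 0 with rfl | hi
    · exact ⟨1, by rw [h00, one_mul]⟩
    obtain ⟨w, t, hwt, ht⟩ := hr (B' i 0) s h0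
    have heq := hB'.add_row 0 (Function.update 0 i (-w)) (by simp [hi.symm])
    have ht' : B' i 0 + -w * s = t := by rw [hwt]; noncomm_ring
    have := hmin _ heq i 0 (by simpa only [Matrix.of_apply, Function.update_self, h00, ht'] using ht)
    refine ⟨w, ?_⟩
    simp only [Matrix.of_apply, Function.update_self, h00, ht'] at this
    rw [hwt, this, add_zero]
  have hrow : ∀ B', MatrixEquivalent M B' → B' 0 0 = s → ∀ j, ∃ w, B' 0 j = s * w := by
    intro B' hB' h00 j
    rcases eq_or_ne j 0 with rfl | hj
    · exact ⟨1, by rw [h00, mul_one]⟩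
    obtain ⟨w, t, hwt, ht⟩ := hl (B' 0 j) s h0
    have heq := hB'.add_col 0 (Function.update 0 j (-w)) (by simp [hj.symm])
    have ht' : B' 0 j + s * -w = t := by rw [hwt]; noncomm_ring
    have := hmin _ heq 0 j (by simpa only [Matrix.of_apply, Function.update_self, h00, ht'] using ht)
    refine ⟨w, ?_⟩
    simp only [Matrix.of_apply, Function.update_self, h00, ht'] at this
    rw [hwt, this, add_zero]
  choose w hw using hcol B hB hs
  have hB₁ := hB.add_row 0 (fun i => if i = 0 then 0 else -w i) (if_pos rfl)
  set B₁ : Matrix (Fin (m + 1)) (Fin (n + 1)) A :=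
    Matrix.of fun i j => B i j + (if i = 0 then 0 else -w i) * B 0 j with hB₁def
  have hs₁ : B₁ 0 0 = s := by simp [hB₁def, hs]
  have hc₁ : ∀ i, i ≠ 0 → B₁ i 0 = 0 := fun i hi => by simp [hB₁def, hi, hs, hw]
  clear_value B₁
  choose x hx using hrow B₁ hB₁ hs₁
  have hB₂ := hB₁.add_col 0 (fun j => if j = 0 then 0 else -x j) (if_pos rfl)
  set B₂ : Matrix (Fin (m + 1)) (Fin (n + 1)) A :=
    Matrix.of fun i j => B₁ i j + B₁ i 0 * (if j = 0 then 0 else -x j) with hB₂def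
  have hs₂ : B₂ 0 0 = s := by simp [hB₂def, hs₁]
  have hc₂ : ∀ i, i ≠ 0 → B₂ i 0 = 0 := fun i hi => by simp [hB₂def, hc₁ i hi]
  have hr₂ : ∀ j, j ≠ 0 → B₂ 0 j = 0 := fun j hj => by simp [hB₂def, hj, hs₁, hx]
  clear_value B₂
  refine ⟨s, Matrix.of fun i j => B₂ i.succ j.succ, ?_, fun i j u => ⟨?_, ?_⟩⟩
  · convert hB₂ using 1
    ext i j
    cases i using Fin.cases <;> cases j using Fin.cases <;>
      simp [hs₂, hc₂, hr₂, Fin.succ_ne_zero]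
  -- Adding u times a lower row to row 0 keeps the corner s, because column 0 is already cleared,
  -- and puts u times the block entry into row 0, where s divides it on the left. The other side is
  -- the same with columns.
  · have heq := hB₂.add_row i.succ (Function.update 0 0 u) (by simp [Fin.succ_ne_zero])
    obtain ⟨y, hy⟩ := hrow _ heq (by simp [hs₂, hc₂ _ (Fin.succ_ne_zero i)]) j.succ
    exact ⟨y, by simpa [hr₂ _ (Fin.succ_ne_zero j)] using hy⟩
  · have heq := hB₂.add_col j.succ (Function.update 0 0 u) (by simp [Fin.succ_ne_zero])
    obtain ⟨y, hy⟩ := hcol _ heq (by simp [hs₂, hr₂ _ (Fin.succ_ne_zero j)]) i.succ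
    exact ⟨y, by simpa [hc₂ _ (Fin.succ_ne_zero i)] using hy⟩

/-- The entries of S M T are two-sided combinations of entries of M. Thus divisibility by the pivot
survives the later reduction of the smaller block. -/
theorem isTotalDivisor_mul_mul {l m n p : Type*} [Fintype m] [Fintype n] {s : A}
    {M : Matrix m n A} (hM : ∀ i j, IsTotalDivisor s (M i j)) (S : Matrix l m A) (T : Matrix n p A)
    (i : l) (j : p) : IsTotalDivisor s ((S * M * T) i j) := by
  simp only [Matrix.mul_apply]
  exact .sum _ fun _ => (IsTotalDivisor.sum _ fun _ => (hM _ _).mul_left _).mul_right _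

/-- Over a Euclidean ring, every matrix with at least as many rows as columns has a Smith normal
form. -/
theorem exists_isSmithNormalForm (μ : A → ℕ)
    (hr : ∀ p s : A, s ≠ 0 → ∃ w t, p = w * s + t ∧ μ t < μ s)
    (hl : ∀ p s : A, s ≠ 0 → ∃ w t, p = s * w + t ∧ μ t < μ s)
    {k N : ℕ} (M : Matrix (Fin (k + N)) (Fin N) A) : ∃ S T h, IsSmithNormalForm M S T h := by
  induction N with
  | zero => exact ⟨1, 1, 0, by ext i j; exact j.elim0, fun i => i.elim0⟩
  | succ N ih =>
    by_cases hM : M = 0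
    · refine ⟨1, 1, 0, ?_, fun i j _ => .zero _⟩
      ext i j
      simp [hM]
    obtain ⟨s, B, ⟨S, T, hST⟩, hs⟩ := exists_matrixEquivalent_consBlock (m := k + N) μ hr hl hM
    obtain ⟨S', T', h', hJ, htd⟩ := ih B
    refine ⟨consBlockUnit S' * S, T * consBlockUnit T', Fin.cons s h', ?_, ?_⟩
    · have : (consBlockUnit S' * S).val * M * (T * consBlockUnit T').val =
          (consBlockUnit S').val * (S.val * M * T.val) * (consBlockUnit T').val := by
        simp only [Units.val_mul, Matrix.mul_assoc]
      rw [this, hST]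
      simp only [consBlockUnit]
      rw [consBlock_mul, consBlock_mul, hJ]
      ext i j
      cases i using Fin.cases <;> cases j using Fin.cases <;> simp
    · intro i j hij
      cases j using Fin.cases with
      | zero => simp at hij
      | succ j =>
        cases i using Fin.cases with
        | zero =>
          -- Each later diagonal element is an entry of the reduced block, so s totally divides it.
          have := isTotalDivisor_mul_mul hs S'.val T'.val (Fin.castLE (Nat.le_add_left N k) j) j
          rw [hJ] at this
          simpa using this
        | succ i => exact htd i j (by simpa using hij)

end Smith

/-! ### Coordinates of words and of vectors of skew polynomials -/

section Coordinates

variable {F K L : Type*} [Field F] [Fintype F] [Field K] [Field L]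
  [Algebra F K] [Algebra F L] [Algebra K L] {n ℓ r : ℕ}

theorem coeffHom_sum_fin (f : Fin n → K) (j : Fin n) :
    coeffHom (j : ℕ) (∑ i : Fin n, monomial F i (f i)) = f j := by
  simp [map_sum, coeffHom_monomial, Fin.val_inj]

theorem size_sum_fin_le (f : Fin n → K) : size (∑ i : Fin n, monomial F i (f i)) ≤ n :=
  size_le_iff.2 fun j hj => by
    rw [map_sum]
    exact Finset.sum_eq_zero fun i _ => by rw [coeffHom_monomial, if_neg (by omega)]

/-- A nonzero multiple of X^n - 1 has degree at least n. -/
theorem eq_of_size_le_of_toRQuot_eq [Finite L] [NeZero n] (hn : Module.finrank F L ∣ n)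
    {p p' : SkewPoly F L} (hp : size p ≤ n) (hp' : size p' ≤ n)
    (h : toRQuot F L n p = toRQuot F L n p') : p = p' := by
  obtain ⟨w, hw⟩ := (mem_xIdeal_iff hn).1 (Ideal.Quotient.eq.1 h)
  have hle : size (p - p') ≤ n := size_le_iff.2 fun i hi => by
    rw [map_sub, size_le_iff.1 hp i hi, size_le_iff.1 hp' i hi, sub_zero]
  rcases eq_or_ne w 0 with rfl | hw0
  · exact sub_eq_zero.1 (by rw [hw, zero_mul])
  · obtain ⟨d, hd⟩ := exists_size_eq_add_one hw0
    have := size_mul hd (size_xPowSubOne (F := F) (K := L) (NeZero.ne n))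
    rw [← hw] at this
    omega

/-- Division by X^n - 1 gives every class exactly one representative of degree below n, whose
coefficients are a column of the array. -/
theorem phi_bijective [Finite L] [NeZero n] (hn : Module.finrank F L ∣ n)
    (τ : Fin n × Fin ℓ ≃ Fin (n * ℓ)) :
    Function.Bijective (phi F τ : (Fin (n * ℓ) → L) → Fin ℓ → RQuot F L n) := by
  constructor
  · intro c c' h
    funext k
    obtain ⟨⟨i, j⟩, rfl⟩ := τ.surjective k
    have := eq_of_size_le_of_toRQuot_eq hn (size_sum_fin_le _) (size_sum_fin_le _) (congrFun h j)
    rw [← coeffHom_sum_fin (F := F) (fun i => c (τ (i, j))) i, this, coeffHom_sum_fin]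
  · intro y
    have hy : ∀ j, ∃ f : Fin n → L, toRQuot F L n (∑ i : Fin n, monomial F i (f i)) = y j := by
      intro j
      obtain ⟨p, hp⟩ := Ideal.Quotient.mk_surjective (y j)
      obtain ⟨w, t, hwt, ht⟩ := exists_eq_mul_add p
        (xPowSubOne_ne_zero (F := F) (K := L) (NeZero.ne n))
      rw [size_xPowSubOne (NeZero.ne n), Nat.lt_succ_iff] at ht
      refine ⟨fun i => coeffHom i t, ?_⟩
      rw [Fin.sum_univ_eq_sum_range (fun i => monomial F i (coeffHom i t)) n,
        sum_monomial_coeffHom ht, ← hp]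
      change _ = toRQuot F L n p
      rw [hwt, map_add, map_mul, toRQuot_xPowSubOne, mul_zero, zero_add]
    choose f hf using hy
    refine ⟨fun k => f (τ.symm k).2 (τ.symm k).1, funext fun j => ?_⟩
    simpa [phi] using hf j

variable (F L) in
/-- The `k`-th power of the Frobenius `σ x = x ^ q`, as a ring homomorphism. -/
def frobeniusPow (k : ℕ) : L →+* L :=
  letI := frobeniusAction F L
  MulSemiringAction.toRingHom (Multiplicative ℕ) L (Multiplicative.ofAdd k)

theorem frobeniusPow_apply (k : ℕ) (x : L) : frobeniusPow F L k x = x ^ (Fintype.card F ^ k) := rfl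

-- The elements σ^k(b_i) again form a K-basis of L, since σ^k is bijective on both L and K. They
-- occur because moving b_i past X^k turns it into σ^k(b_i).
variable (F) in
theorem bijective_sum_mul_frobenius [Finite L] (b : Module.Basis (Fin r) K L) (k : ℕ) :
    Function.Bijective fun u : Fin r → K =>
      ∑ i, algebraMap K L (u i) * b i ^ (Fintype.card F ^ k) := by
  have hK : Finite K := Finite.of_injective _ (algebraMap K L).injective
  have key : ∀ x : Fin r → K, ∑ i, algebraMap K L (x i ^ (Fintype.card F ^ k)) *
      b i ^ (Fintype.card F ^ k) = (∑ i, x i • b i) ^ (Fintype.card F ^ k) := by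
    intro x
    rw [← frobeniusPow_apply, map_sum]
    simp only [frobeniusPow_apply, Algebra.smul_def, mul_pow, map_pow]
  constructor
  · intro u u' h
    choose x hx using fun i => frobenius_pow_surjective F (K := K) k (u i)
    choose x' hx' using fun i => frobenius_pow_surjective F (K := K) k (u' i)
    obtain rfl : _ = u := funext hx
    obtain rfl : _ = u' := funext hx'
    simp only [key] at h
    have h' := (frobeniusPow F L k).injective h
    rw [← b.equivFun_symm_apply, ← b.equivFun_symm_apply] at h'
    rw [b.equivFun.symm.injective h']
  · intro a
    obtain ⟨y, rfl⟩ := frobenius_pow_surjective F k a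
    exact ⟨fun i => b.repr y i ^ (Fintype.card F ^ k), (key _).trans (by rw [b.sum_repr])⟩

theorem coeffHom_incl_mul (p : SkewPoly F K) (a : L) (k : ℕ) :
    coeffHom k (incl F K L p * monomial F 0 a) =
      algebraMap K L (coeffHom k p) * a ^ (Fintype.card F ^ k) := by
  induction p using skewPoly_induction with
  | h0 => simp
  | hadd p p' hp hp' => simp only [map_add, add_mul, hp, hp']
  | hm i c =>
    rw [incl_monomial, monomial_mul_monomial, coeffHom_monomial, coeffHom_monomial, add_zero]
    split_ifs with h
    · rw [h]
    · simp

theorem coeffHom_assemble (b : Module.Basis (Fin r) K L) (v : Fin (ℓ * r) → SkewPoly F K)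
    (j : Fin ℓ) (k : ℕ) : coeffHom k (assemble F b v j) =
      ∑ i, algebraMap K L (coeffHom k (v (finProdFinEquiv (j, i)))) *
        b i ^ (Fintype.card F ^ k) := by
  simp only [assemble, map_sum, coeffHom_incl_mul]

/-- In degree k the map is the coordinate map of the basis σ^k(b_i), so it can be inverted degree by
degree. -/
theorem assemble_bijective [Finite L] (b : Module.Basis (Fin r) K L) :
    Function.Bijective
      (assemble F b : (Fin (ℓ * r) → SkewPoly F K) → Fin ℓ → SkewPoly F L) := by
  constructor
  · intro v v' h
    funext m
    obtain ⟨⟨j, i⟩, rfl⟩ := finProdFinEquiv.surjective m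
    refine coeffHom_ext fun k => ?_
    have hk := congrArg (coeffHom k) (congrFun h j)
    rw [coeffHom_assemble, coeffHom_assemble] at hk
    exact congrFun ((bijective_sum_mul_frobenius F b k).1 hk) i
  · intro p
    choose u hu using fun (j : Fin ℓ) (k : ℕ) =>
      (bijective_sum_mul_frobenius F b k).2 (coeffHom k (p j))
    refine ⟨fun m => ∑ k ∈ Finset.range (size (p (finProdFinEquiv.symm m).1)),
      monomial F k (u (finProdFinEquiv.symm m).1 k (finProdFinEquiv.symm m).2), ?_⟩
    refine funext fun j => coeffHom_ext fun k => ?_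
    rw [coeffHom_assemble]
    simp only [Equiv.symm_apply_apply, coeffHom_sum_monomial]
    split_ifs with hk
    · exact hu j k
    · simp [coeffHom_eq_zero_of_size_le (not_lt.1 hk)]

theorem proj_assemble_surjective [Finite L] (b : Module.Basis (Fin r) K L) :
    Function.Surjective fun v : Fin (ℓ * r) → SkewPoly F K =>
      (proj F n (assemble F b v) : Fin ℓ → RQuot F L n) := by
  intro y
  choose p hp using fun j => Ideal.Quotient.mk_surjective (y j)
  obtain ⟨v, hv⟩ := (assemble_bijective b).2 p
  exact ⟨v, funext fun j => by simp only [hv]; exact hp j⟩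

/-- Lifts of a K-basis of C suffice, because the constants of P_n act as the scalars of K. -/
theorem exists_generators [Finite L] [NeZero n] (b : Module.Basis (Fin r) K L)
    (τ : Fin n × Fin ℓ ≃ Fin (n * ℓ)) (C : Submodule K (Fin (n * ℓ) → L))
    (hC : IsSkewQuasiCyclic F τ C) :
    ∃ g : Fin (Module.finrank K C) → Fin (ℓ * r) → SkewPoly F K,
      Submodule.span (PQuot F K n) (Set.range fun i => proj F n (assemble F b (g i))) =
        codeModule F τ C hC := by
  let B := Module.finBasis K C
  choose g hg using fun i => proj_assemble_surjective (F := F) (n := n) b (phi F τ (B i : _ → L))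
  simp only at hg
  refine ⟨g, ?_⟩
  simp only [hg]
  refine le_antisymm (Submodule.span_le.2 ?_) ?_
  · rintro _ ⟨i, rfl⟩
    exact ⟨_, (B i).2, rfl⟩
  · rintro _ ⟨c, hc, rfl⟩
    suffices h : ∀ x : C, phi F τ (x : _ → L) ∈ Submodule.span (PQuot F K n)
        (Set.range fun i => phi F τ (B i : _ → L)) from h ⟨c, hc⟩
    intro x
    induction B.mem_span x using Submodule.span_induction with
    | mem x hx =>
      obtain ⟨i, rfl⟩ := hx
      exact Submodule.subset_span ⟨i, rfl⟩
    | zero => rw [ZeroMemClass.coe_zero, phi_zero]; exact Submodule.zero_mem _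
    | add x y _ _ hx hy => rw [Submodule.coe_add, ← phi_add]; exact Submodule.add_mem _ hx hy
    | smul a x _ hx => rw [Submodule.coe_smul, ← phi_smul F K]; exact Submodule.smul_mem _ _ hx

end Coordinates

/-! ### Bases given by a Smith normal form -/

section Rows

variable {A : Type*} [Ring A] {N : ℕ}

theorem stackedBasis_sum (T : (Matrix (Fin N) (Fin N) A)ˣ) (f : Fin N → A) :
    ∑ i, f i • stackedBasis T i = Matrix.vecMul f T⁻¹.val := by
  rw [Matrix.vecMul_eq_sum]
  rfl

theorem linearIndependent_stackedBasis (T : (Matrix (Fin N) (Fin N) A)ˣ) :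
    LinearIndependent A (stackedBasis T) := by
  rw [Fintype.linearIndependent_iff]
  intro f hf i
  rw [stackedBasis_sum] at hf
  have := congrArg (fun v => Matrix.vecMul v T.val) hf
  simp only [Matrix.vecMul_vecMul, ← Units.val_mul, inv_mul_cancel, Units.val_one,
    Matrix.vecMul_one, Matrix.zero_vecMul] at this
  exact congrFun this i

theorem span_stackedBasis (T : (Matrix (Fin N) (Fin N) A)ˣ) :
    Submodule.span A (Set.range (stackedBasis T)) = ⊤ := by
  refine eq_top_iff.2 fun v _ => ?_
  rw [Submodule.mem_span_range_iff_exists_fun]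
  refine ⟨Matrix.vecMul v T.val, ?_⟩
  rw [stackedBasis_sum, Matrix.vecMul_vecMul, ← Units.val_mul, mul_inv_cancel, Units.val_one,
    Matrix.vecMul_one]

theorem _root_.LinearIndependent.smul_of_ne_zero [NoZeroDivisors A] {ι V : Type*} [Fintype ι]
    [AddCommGroup V] [Module A V] {q : ι → V} (hq : LinearIndependent A q) {a : ι → A}
    (ha : ∀ i, a i ≠ 0) : LinearIndependent A fun i => a i • q i := by
  rw [Fintype.linearIndependent_iff] at hq ⊢
  intro f hf i
  simp only [smul_smul] at hf
  exact (mul_eq_zero.1 (hq _ hf i)).resolve_right (ha i)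

/-- The rows `hᵢ qᵢ` given by a Smith normal form of `M` span the row space of `M`. -/
theorem IsSmithNormalForm.span_codeBasis {k : ℕ} {M : Matrix (Fin (k + N)) (Fin N) A}
    {S : (Matrix (Fin (k + N)) (Fin (k + N)) A)ˣ} {T : (Matrix (Fin N) (Fin N) A)ˣ}
    {h : Fin N → A} (hJ : IsSmithNormalForm M S T h) :
    Submodule.span A (Set.range (codeBasis T h)) =
      Submodule.span A (Set.range fun i : Fin (k + N) => M i) := by
  have hmem : ∀ v, v ∈ Submodule.span A (Set.range fun i : Fin (k + N) => M i) ↔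
      ∃ x, Matrix.vecMul x M = v := by
    intro v
    rw [Submodule.mem_span_range_iff_exists_fun]
    simp only [Matrix.vecMul_eq_sum]
  have hSM : M = S⁻¹.val * (Matrix.of (fun (i : Fin (k + N)) (j : Fin N) =>
      if (i : ℕ) = (j : ℕ) then h j else 0) * T⁻¹.val) := by
    rw [← hJ.1, Matrix.mul_assoc, Matrix.mul_assoc, ← Units.val_mul T, mul_inv_cancel,
      Units.val_one, Matrix.mul_one, ← Matrix.mul_assoc, ← Units.val_mul, inv_mul_cancel,
      Units.val_one, Matrix.one_mul]
  -- x S M = x J T⁻¹, and column j of J contains only h_j, in row j; the last k entries of x are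
  -- lost.
  have hrow : ∀ x : Fin (k + N) → A, Matrix.vecMul (Matrix.vecMul x S.val) M =
      ∑ j : Fin N, x (Fin.castLE (Nat.le_add_left N k) j) • codeBasis T h j := by
    intro x
    simp only [codeBasis, smul_smul]
    rw [stackedBasis_sum, hSM, Matrix.vecMul_vecMul, ← Matrix.mul_assoc, ← Units.val_mul,
      mul_inv_cancel, Units.val_one, Matrix.one_mul, ← Matrix.vecMul_vecMul]
    congr 1
    funext j
    rw [Matrix.vecMul, dotProduct, Finset.sum_eq_single (Fin.castLE (Nat.le_add_left N k) j)]
    · simp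
    · intro i _ hi
      rw [Matrix.of_apply, if_neg (fun h' : (i : ℕ) = (j : ℕ) => hi (Fin.ext h')), mul_zero]
    · simp
  ext v
  rw [hmem, Submodule.mem_span_range_iff_exists_fun]
  constructor
  · rintro ⟨f, rfl⟩
    -- The values on the last k rows do not matter, as those rows of J are zero.
    refine ⟨Matrix.vecMul (fun i : Fin (k + N) => if hi : (i : ℕ) < N then f ⟨i, hi⟩ else 0) S.val, ?_⟩
    rw [hrow]
    simp
  · rintro ⟨x, rfl⟩
    refine ⟨_, ((hrow (Matrix.vecMul x S⁻¹.val)).symm.trans ?_)⟩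
    rw [Matrix.vecMul_vecMul x S⁻¹.val S.val, ← Units.val_mul, inv_mul_cancel, Units.val_one,
      Matrix.vecMul_one]

theorem exists_quotientEquiv {V W : Type*} [AddCommGroup V] [Module A V] [AddCommGroup W]
    [Module A W] {X : Submodule A V} (ψ : V →ₗ[A] W) (hψ : Function.Surjective ψ)
    (hX : X = LinearMap.ker ψ) :
    ∃ e : (V ⧸ X) ≃ₗ[A] W, ∀ v, e (Submodule.Quotient.mk v) = ψ v := by
  subst hX
  exact ⟨ψ.quotKerEquivOfSurjective hψ, fun v => rfl⟩

open DirectSum in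
/-- The quotient of the free module with the basis `cᵢ` by the span of the vectors `dᵢ cᵢ`. -/
theorem exists_quotientEquiv_directSum {V : Type*} [AddCommGroup V] [Module A V] {c : Fin N → V}
    (hc : LinearIndependent A c) {P X : Submodule A V}
    (hP : Submodule.span A (Set.range c) = P) {d : Fin N → A}
    (hX : Submodule.span A (Set.range fun i => d i • c i) = X) :
    ∃ e : (P ⧸ X.submoduleOf P) ≃ₗ[A] ⨁ i, A ⧸ Ideal.span {d i},
      ∀ (f : Fin N → A) (v : P), (v : V) = ∑ i, f i • c i →
        ∀ i, e (Submodule.Quotient.mk v) i = Submodule.Quotient.mk (f i) := by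
  subst hP
  let R := Module.Basis.span hc
  have hR : ∀ i, (R i : V) = c i := fun i =>
    congrArg Subtype.val (Module.Basis.span_apply hc i)
  have hcoe : ∀ f : Fin N → A, ((∑ i, f i • R i : Submodule.span A (Set.range c)) : V) =
      ∑ i, f i • c i := by
    intro f
    simp [hR]
  have hrepr : ∀ (f : Fin N → A) (v : Submodule.span A (Set.range c)),
      (v : V) = ∑ i, f i • c i → R.equivFun v = f := by
    intro f v hv
    rw [← R.equivFun.eq_symm_apply, R.equivFun_symm_apply]
    exact Subtype.ext (hv.trans (hcoe f).symm)
  -- Coordinates in the basis (c_i), reduced modulo the left ideals A d_i; the kernel consists of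
  -- the vectors with coordinates w_i d_i.
  let ψ : Submodule.span A (Set.range c) →ₗ[A] ⨁ i, A ⧸ Ideal.span {d i} :=
    (DirectSum.linearEquivFunOnFintype A (Fin N) fun i => A ⧸ Ideal.span {d i}).symm.toLinearMap ∘ₗ
      (LinearMap.pi fun i => (Submodule.mkQ (Ideal.span {d i})) ∘ₗ LinearMap.proj i) ∘ₗ
        R.equivFun.toLinearMap
  have hψ : ∀ v i, ψ v i = Submodule.Quotient.mk (R.equivFun v i) := fun v i => rfl
  have hsurj : Function.Surjective ψ := by
    intro y
    choose f hf using fun i => Submodule.Quotient.mk_surjective _ (y i)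
    refine ⟨R.equivFun.symm f, DFinsupp.ext fun i => ?_⟩
    exact (hψ _ i).trans (by rw [LinearEquiv.apply_symm_apply]; exact hf i)
  have hker : X.submoduleOf (Submodule.span A (Set.range c)) = LinearMap.ker ψ := by
    ext v
    change (v : V) ∈ X ↔ _
    rw [LinearMap.mem_ker, ← hX, Submodule.mem_span_range_iff_exists_fun]
    constructor
    · rintro ⟨w, hw⟩
      refine DFinsupp.ext fun i => (hψ v i).trans ?_
      rw [hrepr (fun i => w i * d i) v (by simp only [← hw, smul_smul])]
      exact (Submodule.Quotient.mk_eq_zero _).2 (Ideal.mem_span_singleton'.2 ⟨w i, rfl⟩)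
    · intro h
      have hw : ∀ i, ∃ w, w * d i = R.equivFun v i := fun i => by
        rw [← Ideal.mem_span_singleton', ← Submodule.Quotient.mk_eq_zero, ← hψ, h]
        rfl
      choose w hw using hw
      refine ⟨w, ?_⟩
      simp only [smul_smul, hw]
      rw [← hcoe, R.sum_equivFun]
  obtain ⟨e, he⟩ := exists_quotientEquiv (V := Submodule.span A (Set.range c))
    (W := ⨁ i, A ⧸ Ideal.span {d i}) (X := X.submoduleOf (Submodule.span A (Set.range c)))
    ψ hsurj hker
  refine ⟨e, fun f v hv i => ?_⟩
  rw [he, hψ, hrepr f v hv]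

end Rows

/-! ### The preimage of the code and the kernel of the projection -/

section Preimage

variable {F K L : Type*} [Field F] [Fintype F] [Field K] [Field L]
  [Algebra F K] [Algebra F L] [Algebra K L] {n ℓ r : ℕ}

theorem xPowSubOne_smul_mem_xSubmodule {N : ℕ} (w : Fin N → SkewPoly F K) :
    xPowSubOne F K n • w ∈ xSubmodule F K n N :=
  Submodule.subset_span ⟨w, rfl⟩

/-- Centrality of X^n - 1 makes its set of multiples stable under left scalars, so no span is
needed. -/
theorem mem_xSubmodule_iff [Finite K] (hn : Module.finrank F K ∣ n) {N : ℕ}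
    {v : Fin N → SkewPoly F K} : v ∈ xSubmodule F K n N ↔ ∃ w, v = xPowSubOne F K n • w := by
  refine ⟨fun hv => ?_, ?_⟩
  · induction hv using Submodule.span_induction with
    | mem v hv =>
      obtain ⟨w, rfl⟩ := hv
      exact ⟨w, rfl⟩
    | zero => exact ⟨0, (smul_zero _).symm⟩
    | add v v' _ _ hv hv' =>
      obtain ⟨w, rfl⟩ := hv
      obtain ⟨w', rfl⟩ := hv'
      exact ⟨w + w', (smul_add _ _ _).symm⟩
    | smul p v _ hv =>
      obtain ⟨w, rfl⟩ := hv
      exact ⟨p • w, by rw [smul_smul, smul_smul, (xPowSubOne_commute hn p).eq]⟩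
  · rintro ⟨w, rfl⟩
    exact xPowSubOne_smul_mem_xSubmodule w

theorem toPQuot_xPowSubOne : toPQuot F K n (xPowSubOne F K n) = 0 :=
  Ideal.Quotient.eq_zero_iff_mem.2 (xPowSubOne_mem_xIdeal F K n)

theorem assemble_smul (b : Module.Basis (Fin r) K L) (p : SkewPoly F K)
    (v : Fin (ℓ * r) → SkewPoly F K) (j : Fin ℓ) :
    assemble F b (p • v) j = incl F K L p * assemble F b v j := by
  simp only [assemble, Pi.smul_apply, smul_eq_mul, map_mul, mul_assoc, Finset.mul_sum]

variable (F n ℓ) in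
/-- The map `K[X; σ] ^ (ℓ * r) ≅ L[X; σ] ^ ℓ → Rₙ ^ ℓ` as an additive homomorphism. -/
def projAssemble (b : Module.Basis (Fin r) K L) :
    (Fin (ℓ * r) → SkewPoly F K) →+ (Fin ℓ → RQuot F L n) :=
  AddMonoidHom.mk' (fun v => proj F n (assemble F b v)) (proj_assemble_add F b)

theorem projAssemble_apply (b : Module.Basis (Fin r) K L) (v : Fin (ℓ * r) → SkewPoly F K) :
    projAssemble F n ℓ b v = proj F n (assemble F b v) := rfl

theorem projAssemble_smul (b : Module.Basis (Fin r) K L) (p : SkewPoly F K)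
    (v : Fin (ℓ * r) → SkewPoly F K) :
    projAssemble F n ℓ b (p • v) = toPQuot F K n p • projAssemble F n ℓ b v :=
  proj_assemble_smul F b p v

/-- X^n - 1 is central in L[X;σ] too, so the entrywise quotients can be put on its right and pulled
back to coordinates over K[X;σ]. -/
theorem proj_assemble_eq_zero_iff [Finite L] (hn : Module.finrank F L ∣ n)
    (b : Module.Basis (Fin r) K L) {v : Fin (ℓ * r) → SkewPoly F K} :
    (proj F n (assemble F b v) : Fin ℓ → RQuot F L n) = 0 ↔ v ∈ xSubmodule F K n (ℓ * r) := by
  constructor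
  · intro h
    choose w hw using fun j => (mem_xIdeal_iff hn).1 (Ideal.Quotient.eq_zero_iff_mem.1 (congrFun h j))
    obtain ⟨w', rfl⟩ := (assemble_bijective b).2 w
    have : v = xPowSubOne F K n • w' := by
      refine (assemble_bijective (F := F) b).1 (funext fun j => ?_)
      rw [hw, assemble_smul, incl_xPowSubOne, (xPowSubOne_commute hn _).eq]
    rw [this]
    exact xPowSubOne_smul_mem_xSubmodule w'
  · intro hv
    rw [← projAssemble_apply]
    induction hv using Submodule.span_induction with
    | mem v hv =>
      obtain ⟨w, rfl⟩ := hv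
      change projAssemble F n ℓ b (xPowSubOne F K n • w) = 0
      rw [projAssemble_smul, toPQuot_xPowSubOne, zero_smul]
    | zero => exact map_zero _
    | add v v' _ _ hv hv' => rw [map_add, hv, hv', add_zero]
    | smul p v _ hv => rw [projAssemble_smul, hv, smul_zero]

theorem xSubmodule_le_preimage [Finite L] (hn : Module.finrank F L ∣ n)
    (b : Module.Basis (Fin r) K L) (C : Submodule (PQuot F K n) (Fin ℓ → RQuot F L n)) :
    xSubmodule F K n (ℓ * r) ≤ preimage F b C := fun v hv => by
  change proj F n (assemble F b v) ∈ C
  rw [(proj_assemble_eq_zero_iff hn b).2 hv]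
  exact C.zero_mem

theorem stackedMatrix_castAdd {k N : ℕ} (g : Fin k → Fin N → SkewPoly F K) (i : Fin k) :
    stackedMatrix n g (Fin.castAdd N i) = g i := by
  funext j
  simp [stackedMatrix]

theorem stackedMatrix_natAdd {k N : ℕ} (g : Fin k → Fin N → SkewPoly F K) (i : Fin N) :
    stackedMatrix n g (Fin.natAdd k i) = Pi.single i (xPowSubOne F K n) := by
  funext j
  simp [stackedMatrix]

/-- The rows of the stacked matrix generate the preimage of the code. -/
theorem span_stackedMatrix [Finite L] (hn : Module.finrank F L ∣ n)
    (hnK : Module.finrank F K ∣ n) (b : Module.Basis (Fin r) K L)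
    {C : Submodule (PQuot F K n) (Fin ℓ → RQuot F L n)} {k : ℕ}
    {g : Fin k → Fin (ℓ * r) → SkewPoly F K}
    (hg : Submodule.span (PQuot F K n) (Set.range fun i => proj F n (assemble F b (g i))) = C) :
    Submodule.span (SkewPoly F K) (Set.range fun i => stackedMatrix n g i) = preimage F b C := by
  have hK : Finite K := Finite.of_injective _ (algebraMap K L).injective
  refine le_antisymm (Submodule.span_le.2 ?_) fun v hv => ?_
  · rintro _ ⟨i, rfl⟩
    dsimp only
    induction i using Fin.addCases with
    | left i =>
      rw [stackedMatrix_castAdd]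
      change proj F n (assemble F b (g i)) ∈ C
      rw [← hg]
      exact Submodule.subset_span ⟨i, rfl⟩
    | right i =>
      rw [stackedMatrix_natAdd]
      refine xSubmodule_le_preimage hn b C ?_
      refine (mem_xSubmodule_iff hnK).2 ⟨Pi.single i 1, ?_⟩
      rw [← Pi.single_smul, smul_eq_mul, mul_one]
  · have hleft : ∀ i, g i ∈ Submodule.span (SkewPoly F K)
        (Set.range fun i => stackedMatrix n g i) := fun i =>
      Submodule.subset_span ⟨Fin.castAdd _ i, stackedMatrix_castAdd g i⟩
    have hright : ∀ i, Pi.single i (xPowSubOne F K n) ∈ Submodule.span (SkewPoly F K)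
        (Set.range fun i => stackedMatrix n g i) := fun i =>
      Submodule.subset_span ⟨Fin.natAdd _ i, stackedMatrix_natAdd g i⟩
    change proj F n (assemble F b v) ∈ C at hv
    rw [← hg, Submodule.mem_span_range_iff_exists_fun] at hv
    obtain ⟨p, hp⟩ := hv
    choose f hf using fun i => toPQuot_surjective F K n (p i)
    -- Lifting the P_n-coefficients changes v only by the kernel of the projection, which the lower
    -- rows of the matrix generate.
    have hker : v - ∑ i, f i • g i ∈ xSubmodule F K n (ℓ * r) := by
      rw [← proj_assemble_eq_zero_iff hn b, ← projAssemble_apply, map_sub, map_sum, sub_eq_zero,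
        projAssemble_apply, ← hp]
      exact Finset.sum_congr rfl fun i _ => by rw [projAssemble_smul, hf, projAssemble_apply]
    obtain ⟨w, hw⟩ := (mem_xSubmodule_iff hnK).1 hker
    rw [sub_eq_iff_eq_add.1 hw]
    refine Submodule.add_mem _ ?_ (Submodule.sum_mem _ fun i _ => Submodule.smul_mem _ _ (hleft i))
    have : xPowSubOne F K n • w = ∑ i, w i • Pi.single i (xPowSubOne F K n) := by
      funext j
      simp [Finset.sum_apply, Pi.single_apply, (xPowSubOne_commute hnK (w j)).eq]
    rw [this]
    exact Submodule.sum_mem _ fun i _ => Submodule.smul_mem _ _ (hright i)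

/-- Put z = X^n - 1. Since z q_i is a combination of the h_j q_j, its i-th coordinate gives z = d_i
h_i. Then (h_i d_i) h_i = h_i z = z h_i, and h_i cancels. -/
theorem exists_complementary_divisors [Finite K] [NeZero n] (hn : Module.finrank F K ∣ n) {N : ℕ}
    {T : (Matrix (Fin N) (Fin N) (SkewPoly F K))ˣ} {h : Fin N → SkewPoly F K}
    (hq : LinearIndependent (SkewPoly F K) (stackedBasis T))
    (hX : xSubmodule F K n N ≤ Submodule.span (SkewPoly F K) (Set.range (codeBasis T h))) :
    ∃ d : Fin N → SkewPoly F K,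
      ∀ i, h i * d i = xPowSubOne F K n ∧ d i * h i = xPowSubOne F K n := by
  have hz : xPowSubOne F K n ≠ 0 := xPowSubOne_ne_zero (NeZero.ne n)
  have key : ∀ i, ∃ d, d * h i = xPowSubOne F K n := by
    intro i
    have hi := hX (xPowSubOne_smul_mem_xSubmodule (stackedBasis T i))
    obtain ⟨f, hf⟩ := (Submodule.mem_span_range_iff_exists_fun _).1 hi
    simp only [codeBasis, smul_smul] at hf
    refine ⟨f i, ?_⟩
    have hs : ∑ j, (Pi.single i (xPowSubOne F K n) : Fin N → SkewPoly F K) j • stackedBasis T j =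
        xPowSubOne F K n • stackedBasis T i := by
      rw [Finset.sum_eq_single i, Pi.single_eq_same]
      · intro j _ hj
        rw [Pi.single_eq_of_ne hj, zero_smul]
      · simp
    have := Fintype.linearIndependent_iffₛ.1 hq _ _ (hf.trans hs.symm) i
    rwa [Pi.single_eq_same] at this
  choose d hd using key
  refine ⟨d, fun i => ⟨mul_right_cancel₀ (b := h i) (fun h0 => hz ?_) ?_, hd i⟩⟩
  · rw [← hd i, h0, mul_zero]
  · rw [mul_assoc, hd, (xPowSubOne_commute hn _).eq]

theorem span_smul_codeBasis [Finite K] (hn : Module.finrank F K ∣ n) {N : ℕ}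
    (T : (Matrix (Fin N) (Fin N) (SkewPoly F K))ˣ) {h d : Fin N → SkewPoly F K}
    (hd : ∀ i, h i * d i = xPowSubOne F K n ∧ d i * h i = xPowSubOne F K n) :
    Submodule.span (SkewPoly F K) (Set.range fun i => d i • codeBasis T h i) =
      xSubmodule F K n N := by
  simp only [codeBasis, smul_smul, (hd _).2]
  refine le_antisymm (Submodule.span_le.2 ?_) fun v hv => ?_
  · rintro _ ⟨i, rfl⟩
    exact xPowSubOne_smul_mem_xSubmodule _
  · obtain ⟨w, rfl⟩ := (mem_xSubmodule_iff hn).1 hv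
    have hw : w ∈ Submodule.span (SkewPoly F K) (Set.range (stackedBasis T)) :=
      span_stackedBasis T ▸ Submodule.mem_top
    obtain ⟨f, rfl⟩ := (Submodule.mem_span_range_iff_exists_fun _).1 hw
    rw [Finset.smul_sum]
    refine Submodule.sum_mem _ fun i _ => ?_
    rw [smul_smul, (xPowSubOne_commute hn _).eq, ← smul_smul]
    exact Submodule.smul_mem _ _ (Submodule.subset_span ⟨i, rfl⟩)

/-- The isomorphism `π⁻¹(C) / (X ^ n - 1) K[X; σ] ^ (ℓ * r) ≅ C` induced by the projection. -/
theorem exists_codeQuotientEquiv [Finite L] (hn : Module.finrank F L ∣ n)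
    (b : Module.Basis (Fin r) K L) (C : Submodule (PQuot F K n) (Fin ℓ → RQuot F L n)) :
    ∃ e : CodeQuotient F b C ≃ₗ[SkewPoly F K] C, ∀ v : preimage F b C,
      (e (Submodule.Quotient.mk v) : Fin ℓ → RQuot F L n) = proj F n (assemble F b v) := by
  let ψ : preimage F b C →ₗ[SkewPoly F K] C :=
    { toFun := fun v => ⟨proj F n (assemble F b v), v.2⟩
      map_add' := fun v w => Subtype.ext (proj_assemble_add F b _ _)
      map_smul' := fun p v => Subtype.ext (proj_assemble_smul F b p _) }
  have hsurj : Function.Surjective ψ := by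
    rintro ⟨y, hy⟩
    obtain ⟨v, rfl⟩ := proj_assemble_surjective (F := F) b y
    exact ⟨⟨v, hy⟩, rfl⟩
  have hker : (xSubmodule F K n (ℓ * r)).submoduleOf (preimage F b C) = LinearMap.ker ψ := by
    ext v
    change (v : Fin (ℓ * r) → SkewPoly F K) ∈ xSubmodule F K n (ℓ * r) ↔ _
    rw [LinearMap.mem_ker, ← proj_assemble_eq_zero_iff hn b]
    exact ⟨fun h => Subtype.ext h, fun h => congrArg Subtype.val h⟩
  obtain ⟨e, he⟩ := exists_quotientEquiv ψ hsurj hker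
  exact ⟨e, fun v => congrArg Subtype.val (he v)⟩

end Preimage

end SkewQC

end

open SkewQC DirectSum in
theorem mainTheorem1
    {F K L : Type*} [Field F] [Fintype F] [Field K] [Field L] [Finite L]
    [Algebra F K] [Algebra F L] [Algebra K L] [IsScalarTower F K L]
    {n ℓ r : ℕ} [NeZero n] (hn : Module.finrank F L ∣ n)
    (b : Module.Basis (Fin r) K L)
    (τ : Fin n × Fin ℓ ≃ Fin (n * ℓ)) (C : Submodule K (Fin (n * ℓ) → L))
    (hC : IsSkewQuasiCyclic F τ C) :
    -- `r = m / a`, the code `C` is identified with `φ(C)`, and `L[X; σ] ^ ℓ` with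
    -- `K[X; σ] ^ (ℓ * r)`
    r = Module.finrank F L / Module.finrank F K ∧
    Function.Bijective (phi F τ : (Fin (n * ℓ) → L) → Fin ℓ → RQuot F L n) ∧
    Function.Bijective
      (assemble F b : (Fin (ℓ * r) → SkewPoly F K) → Fin ℓ → SkewPoly F L) ∧
    -- there is a generating family indexed by the `K`-dimension of `C`
    (∃ g : Fin (Module.finrank K C) → Fin (ℓ * r) → SkewPoly F K,
      Submodule.span (PQuot F K n) (Set.range fun i => proj F n (assemble F b (g i))) =
        codeModule F τ C hC) ∧
    -- for every finite generating family:
    ∀ (k : ℕ) (g : Fin k → Fin (ℓ * r) → SkewPoly F K),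
      Submodule.span (PQuot F K n) (Set.range fun i => proj F n (assemble F b (g i))) =
        codeModule F τ C hC →
      -- the matrix whose rows generate `π⁻¹(C)` has a Smith normal form,
      (∃ S T h, IsSmithNormalForm (stackedMatrix n g) S T h) ∧
      -- and every Smith normal form of it gives a decomposition
      ∀ S T h, IsSmithNormalForm (stackedMatrix n g) S T h →
        (LinearIndependent (SkewPoly F K) (stackedBasis T) ∧
          Submodule.span (SkewPoly F K) (Set.range (stackedBasis T)) = ⊤) ∧
        (LinearIndependent (SkewPoly F K) (codeBasis T h) ∧
          Submodule.span (SkewPoly F K) (Set.range (codeBasis T h)) =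
            preimage F b (codeModule F τ C hC)) ∧
        ∃ d : Fin (ℓ * r) → SkewPoly F K,
          (∀ i, h i * d i = xPowSubOne F K n ∧ d i * h i = xPowSubOne F K n) ∧
          (LinearIndependent (SkewPoly F K) (fun i => d i • codeBasis T h i) ∧
            Submodule.span (SkewPoly F K) (Set.range fun i => d i • codeBasis T h i) =
              xSubmodule F K n (ℓ * r)) ∧
          xSubmodule F K n (ℓ * r) ≤ preimage F b (codeModule F τ C hC) ∧
          -- the two modules below are annihilated by `X ^ n - 1`, so that `Pₙ` acts on them
          ∃ (hQ : ∀ x : CodeQuotient F b (codeModule F τ C hC), xPowSubOne F K n • x = 0)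
            (hE : ∀ x : ⨁ i, SkewPoly F K ⧸ Ideal.span {d i}, xPowSubOne F K n • x = 0),
            letI := pModule (M := CodeQuotient F b (codeModule F τ C hC)) hQ
            letI := pModule (M := ⨁ i, SkewPoly F K ⧸ Ideal.span {d i}) hE
            -- `C ≅ π⁻¹(C) / (X ^ n - 1) K[X; σ] ^ (ℓ * r)`, induced by `π`,
            (∃ e : codeModule F τ C hC ≃ₗ[SkewPoly F K]
                CodeQuotient F b (codeModule F τ C hC),
              (∀ (p : PQuot F K n) x, e (p • x) = p • e x) ∧
              ∀ v : preimage F b (codeModule F τ C hC),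
                (e.symm (Submodule.Quotient.mk v) : Fin ℓ → RQuot F L n) =
                  proj F n (assemble F b v)) ∧
            -- which is isomorphic to `⨁ i, K[X; σ] / K[X; σ] dᵢ` by `∑ fᵢ cᵢ ↦ (fᵢ)ᵢ`
            (∃ e : CodeQuotient F b (codeModule F τ C hC) ≃ₗ[SkewPoly F K]
                ⨁ i, SkewPoly F K ⧸ Ideal.span {d i},
              (∀ (p : PQuot F K n) x, e (p • x) = p • e x) ∧
              ∀ (f : Fin (ℓ * r) → SkewPoly F K) (v : preimage F b (codeModule F τ C hC)),
                (v : Fin (ℓ * r) → SkewPoly F K) = ∑ i, f i • codeBasis T h i →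
                  ∀ i, e (Submodule.Quotient.mk v) i = Submodule.Quotient.mk (f i)) := by
  have hK : Finite K := Finite.of_injective _ (algebraMap K L).injective
  have hrank : Module.finrank F K * r = Module.finrank F L := by
    rw [← Module.finrank_mul_finrank F K L, Module.finrank_eq_card_basis b, Fintype.card_fin]
  have hnK : Module.finrank F K ∣ n := (Dvd.intro _ hrank).trans hn
  have hz : xPowSubOne F K n ≠ 0 := xPowSubOne_ne_zero (NeZero.ne n)
  refine ⟨?_, phi_bijective hn τ, assemble_bijective b, exists_generators b τ C hC, ?_⟩
  · have : Module.Finite F K := Module.Finite.of_finite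
    rw [← hrank, Nat.mul_div_cancel_left _ Module.finrank_pos]
  intro k g hg
  -- From here on only the P_n-submodule matters, not the code that it comes from.
  generalize codeModule F τ C hC = D at hg ⊢
  refine ⟨exists_isSmithNormalForm size (fun p s hs => exists_eq_mul_add p hs)
    (fun p s hs => exists_eq_mul_add_left p hs) _, fun S T h hJ => ?_⟩
  have hq := linearIndependent_stackedBasis T
  have hspan : Submodule.span (SkewPoly F K) (Set.range (codeBasis T h)) = preimage F b D :=
    hJ.span_codeBasis.trans (span_stackedMatrix hn hnK b hg)
  have hXP := xSubmodule_le_preimage (F := F) hn b D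
  obtain ⟨d, hd⟩ := exists_complementary_divisors hnK hq (hspan.symm ▸ hXP)
  -- As factors of X^n - 1 ≠ 0, the h_i and d_i are nonzero, so scaling by them preserves
  -- independence in a domain.
  have hh : ∀ i, h i ≠ 0 := fun i h0 => hz (by rw [← (hd i).1, h0, zero_mul])
  have hdz : ∀ i, d i ≠ 0 := fun i h0 => hz (by rw [← (hd i).1, h0, mul_zero])
  have hc : LinearIndependent (SkewPoly F K) (codeBasis T h) := hq.smul_of_ne_zero hh
  have hdspan := span_smul_codeBasis hnK T hd
  refine ⟨⟨hq, span_stackedBasis T⟩, ⟨hc, hspan⟩, d, hd, ⟨hc.smul_of_ne_zero hdz, hdspan⟩, hXP,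
    ?_, ?_, ?_, ?_⟩
  · intro x
    obtain ⟨v, rfl⟩ := Submodule.Quotient.mk_surjective _ x
    rw [← Submodule.Quotient.mk_smul]
    exact (Submodule.Quotient.mk_eq_zero _).2 (xPowSubOne_smul_mem_xSubmodule v.1)
  · intro x
    refine DFinsupp.ext fun i => ?_
    rw [DirectSum.smul_apply]
    obtain ⟨a, ha⟩ := Submodule.Quotient.mk_surjective _ (x i)
    rw [← ha, ← Submodule.Quotient.mk_smul]
    -- (X^n - 1) a = a (X^n - 1) = (a h_i) d_i.
    refine (Submodule.Quotient.mk_eq_zero _).2 (Ideal.mem_span_singleton'.2 ⟨a * h i, ?_⟩)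
    rw [mul_assoc, (hd i).1, smul_eq_mul, (xPowSubOne_commute hnK a).eq]
  · obtain ⟨e, he⟩ := exists_codeQuotientEquiv (F := F) hn b D
    refine ⟨e.symm, fun p x => ?_, fun v => ?_⟩
    -- A class in P_n acts through any representative, so P_n-linearity is K[X;σ]-linearity.
    · obtain ⟨p, rfl⟩ := toPQuot_surjective F K n p
      exact e.symm.map_smul p x
    · rw [LinearEquiv.symm_symm, he]
  · obtain ⟨e, he⟩ := exists_quotientEquiv_directSum hc hspan hdspan
    refine ⟨e, fun p x => ?_, he⟩
    obtain ⟨p, rfl⟩ := toPQuot_surjective F K n p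
    exact e.map_smul p x
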